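/- Let $M$ be a smooth manifold of dimension $n$, $b\in M$, $k,r,N\ge 0$, and let $\mathbb F$ be a finite field extension of the field $\mathbb R(u)$ of rational functions in one variable $u$. Consider germs at points $(b,y)$ of operators $A=\sum_{|\sigma|\le k}a_\sigma(x,u)\,\partial_x^\sigma$ on $M\times\mathbb R$ whose coefficients are smooth and belong to $\mathbb F$ (as functions of $u$, along a branch of $\mathbb F$ near $y$) when $x$ is fixed; they define the $\mathbb F$-nonlinear operators $f\mapsto \sum_\sigma a_\sigma(x,f)\,\partial_x^\sigma f$. A related pair is a pair $(A,f)$ with $f$ a smooth function near $b$ and $f(b)=y$. In local coordinates at $b$ the jets of related pairs over $b$ have the coordinates $u$, $a_{\sigma,\beta,j}=\partial_x^\beta\partial_u^j a_\sigma$ ($|\sigma|\le k$, $\beta$ any multi-index, $j\ge 0$) and $p_\gamma=\partial_x^\gamma f$ ($\gamma\ne 0$). Let $\mathcal Q(r)=\mathbb F(a_{\sigma,\beta,j},\,p_\gamma : 1\le|\gamma|\le r)$; thus $\mathcal Q(0)=\mathbb F(a_{\sigma,\beta,j})$. A local diffeomorphism $\varphi$ of $M$ with $\varphi(b)=b$ acts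 on related pairs by $(A,f)\mapsto(\varphi^{(0)}_*A,\ f\circ\varphi^{-1})$, where $\varphi^{(0)}(x,u)=(\varphi(x),u)$ and $(\varphi^{(0)}_*A)(g)=A(g\circ\varphi)\circ(\varphi^{(0)})^{-1}$. Let $\mathcal F(r)\subset\mathcal Q(r)$ be the set of elements whose values on the jets of $(A,f)$ and of its image coincide (wherever both are defined) for all such $\varphi$, $A$, $f$. The elements of $\mathcal F(r)$ are the invariants of related pairs, and those of $\mathcal F(0)$ are the natural invariants of $\mathbb F$-nonlinear differential operators. Let $\nabla$ be the derivation with $\nabla w=dw/du$ for $w\in\mathbb F$, $\nabla a_{\sigma,\beta,j}=a_{\sigma,\beta,j+1}$ and $\nabla p_\gamma=0$. **Theorem.** Let $I_0\in\mathcal F(r)$ and $I_i=\nabla^i I_0$ for $1\le i\le N$, and let $\mathcal J\subset\mathcal Q(0)[X_0,\dots,X_N]$ be the ideal of all polynomials $P$ with $P(I_0,\dots,I_N)=0$. Then $\mathcal J$ has exactly one reduced Groebner basis $b_1,\dots,b_K$ with respect to the lexicographic order with $X_0>X_1>\dots>X_N$, and all coefficients of the polynomials $b_1,\dots,b_K$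 are natural invariants of $\mathbb F$-nonlinear differential operators. -/

import Mathlib

open scoped Manifold ContDiff TensorProduct

noncomputable section

namespace RelatedPairs

/-! ### Multi-indices and partial derivatives in coordinates -/

/-- The multi-indices `σ = (σ₁, …, σₙ)` with `|σ| ≤ k`. -/
def multiIndices (n k : ℕ) : Finset (Fin n → ℕ) :=
  (Fintype.piFinset fun _ => Finset.range (k + 1)).filter fun σ => ∑ i, σ i ≤ k

theorem mem_multiIndices {n k : ℕ} {σ : Fin n → ℕ} :
    σ ∈ multiIndices n k ↔ ∑ i, σ i ≤ k := by
  unfold multiIndices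
  simp only [Finset.mem_filter, Fintype.mem_piFinset, Finset.mem_range, and_iff_right_iff_imp]
  intro h i
  have := Finset.single_le_sum (f := σ) (fun j _ => Nat.zero_le _) (Finset.mem_univ i)
  omega

/-- The partial derivative `∂f/∂xᵢ` on `ℝⁿ`. -/
def partialD {n : ℕ} (i : Fin n) (f : EuclideanSpace ℝ (Fin n) → ℝ) :
    EuclideanSpace ℝ (Fin n) → ℝ :=
  fun x => fderiv ℝ f x (EuclideanSpace.single i 1)

/-- The iterated partial derivative `∂^|σ| f / ∂x^σ`. -/
def multiD {n : ℕ} (σ : Fin n → ℕ) (f : EuclideanSpace ℝ (Fin n) → ℝ) :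
    EuclideanSpace ℝ (Fin n) → ℝ :=
  (List.finRange n).foldr (fun i g => (partialD i)^[σ i] g) f

/-! ### Jet coordinates and the fields of rational functions on the fibre over the base point -/

/-- The coordinates, besides `u`, on the fibre over the base point of the bundle of related pairs
`([A]^∞_{(x,u)}, [f]^∞_x)`, `f(x) = u`:
* `a_{σ,β,j}`, the value of `∂_x^β ∂_u^j a_σ`, where `A = ∑_{|σ| ≤ k} a_σ(x,u) ∂_x^σ`;
* `p_γ` for `γ ≠ 0`, the value of `∂_x^γ f` (for `γ = 0` this value is `u`). -/
abbrev JetVar (n k : ℕ) : Type :=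
  (↥(multiIndices n k) × (Fin n → ℕ) × ℕ) ⊕ {γ : Fin n → ℕ // γ ≠ 0}

variable (F : Type*) [Field F] [Algebra (RatFunc ℝ) F]

/-- Polynomials in the jet coordinates with coefficients in `F`. -/
abbrev JetPoly (n k : ℕ) : Type _ := MvPolynomial (JetVar n k) F

/-- The field `F(a_{σ,β,j}, p_γ)`: rational functions of the jet coordinates (of all orders) on the
fibre over the base point, with coefficients in the field `F ⊇ ℝ(u)`. -/
abbrev JetField (n k : ℕ) : Type _ := FractionRing (JetPoly F n k)

/-- A jet coordinate as an element of the field. -/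
def coord (n k : ℕ) (v : JetVar n k) : JetField F n k :=
  algebraMap (JetPoly F n k) (JetField F n k) (MvPolynomial.X v)

/-- The field `𝒬(r)`: the functions of the jets of `A` of arbitrary order and of the jet of `f` of
order at most `r`. In particular `𝒬(0)` consists of the functions of the jets of `A` (and of `u`)
only. -/
def fieldQ (n k r : ℕ) : IntermediateField F (JetField F n k) :=
  IntermediateField.adjoin F
    {x | (∃ s, x = coord F n k (Sum.inl s)) ∨
      ∃ γ, ∑ i, γ.1 i ≤ r ∧ x = coord F n k (Sum.inr γ)}

/-! ### The invariant derivation `∇ = d/du ⊗ ∂_u^{(r)}` -/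

/-- The derivations of a commutative ring. -/
abbrev RingDerivation (R : Type*) [CommRing R] : Type _ := Derivation ℤ R R

/-- Extension of a derivation along a formally étale algebra (a localization, or a separable
algebraic extension of fields), through the isomorphism of Kähler differentials. -/
def etaleExtend (R S : Type*) [CommRing R] [CommRing S] [Algebra R S] [Algebra.FormallyEtale R S]
    (d : RingDerivation R) : RingDerivation S :=
  (((LinearMap.liftBaseChange S
      (((Algebra.linearMap R S).compDer d).liftKaehlerDifferential)) ∘ₗ
    (KaehlerDifferential.tensorKaehlerEquivOfFormallyEtale ℤ R S).symm.toLinearMap).compDer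
      (KaehlerDifferential.D ℤ S))

theorem etaleExtend_algebraMap (R S : Type*) [CommRing R] [CommRing S] [Algebra R S]
    [Algebra.FormallyEtale R S] (d : RingDerivation R) (x : R) :
    etaleExtend R S d (algebraMap R S x) = algebraMap R S (d x) := by
  simp [etaleExtend, KaehlerDifferential.tensorKaehlerEquivOfFormallyEtale_symm_D_algebraMap]

/-- The derivation `d/du` of `ℝ(u)`. -/
def ratDeriv : RingDerivation (RatFunc ℝ) :=
  haveI : Algebra.FormallyEtale (Polynomial ℝ) (RatFunc ℝ) :=
    Algebra.FormallyEtale.of_isLocalization (nonZeroDivisors (Polynomial ℝ))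
  etaleExtend (Polynomial ℝ) (RatFunc ℝ) ((Polynomial.derivative' (R := ℝ)).restrictScalars ℤ)

/-- The derivation `d/du` of the finite extension `F` of `ℝ(u)`. -/
def fieldDeriv [FiniteDimensional (RatFunc ℝ) F] : RingDerivation F :=
  haveI : Algebra.FormallyEtale (RatFunc ℝ) F := Algebra.FormallyEtale.of_isSeparable _ _
  etaleExtend (RatFunc ℝ) F ratDeriv

/-- The ring homomorphism `p ↦ p + ε D p` with `D w = dw/du` for `w ∈ F` and `D X_v = e v`. -/
def polyDerivHom [FiniteDimensional (RatFunc ℝ) F] {V : Type*} (e : V → MvPolynomial V F) :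
    MvPolynomial V F →+* TrivSqZeroExt (MvPolynomial V F) (MvPolynomial V F) :=
  MvPolynomial.eval₂Hom
    { toFun := fun w => TrivSqZeroExt.inl (MvPolynomial.C w) +
        TrivSqZeroExt.inr (MvPolynomial.C (fieldDeriv F w))
      map_one' := by simp
      map_zero' := by simp
      map_mul' := fun x y => by
        apply TrivSqZeroExt.ext
        · simp
        · simp [Derivation.leibniz, mul_comm]
      map_add' := fun x y => by
        apply TrivSqZeroExt.ext <;> simp }
    (fun v => TrivSqZeroExt.inl (MvPolynomial.X v) + TrivSqZeroExt.inr (e v))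

theorem polyDerivHom_fst [FiniteDimensional (RatFunc ℝ) F] {V : Type*}
    (e : V → MvPolynomial V F) (p : MvPolynomial V F) : (polyDerivHom F e p).fst = p := by
  have h : ((TrivSqZeroExt.fstHom ℤ (MvPolynomial V F) (MvPolynomial V F)).toRingHom.comp
      (polyDerivHom F e)) = RingHom.id _ := by
    apply MvPolynomial.ringHom_ext
    · intro w; simp [polyDerivHom]
    · intro v; simp [polyDerivHom]
  exact congrArg (fun g => g p) h

/-- The derivation of `F[X_v]` extending `d/du` on `F`, with prescribed values at the variables. -/
def polyDeriv [FiniteDimensional (RatFunc ℝ) F] {V : Type*} (e : V → MvPolynomial V F) :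
    RingDerivation (MvPolynomial V F) :=
  Derivation.mk'
    ((AddMonoidHom.mk' (fun p => (polyDerivHom F e p).snd) (by intros; simp)).toIntLinearMap)
    (by intro a b; simp [polyDerivHom_fst, mul_comm])

/-- The values of `∇` at the jet coordinates: `a_{σ,β,j} ↦ a_{σ,β,j+1}` by the total derivative
`d/du`, and `p_γ ↦ 0` because the prolongation of `∂_u` (the shift `f ↦ f + t`) does not change the
derivatives of `f`. -/
def shiftVar (n k : ℕ) : JetVar n k → JetPoly F n k
  | Sum.inl (σ, β, j) => MvPolynomial.X (Sum.inl (σ, β, j + 1))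
  | Sum.inr _ => 0

/-- The derivation `∇`: it is `d/du` on `F`, and `shiftVar` on the jet coordinates. -/
def nabla [FiniteDimensional (RatFunc ℝ) F] (n k : ℕ) :
    RingDerivation (JetField F n k) :=
  haveI : Algebra.FormallyEtale (JetPoly F n k) (JetField F n k) :=
    Algebra.FormallyEtale.of_isLocalization (nonZeroDivisors (JetPoly F n k))
  etaleExtend (JetPoly F n k) (JetField F n k) (polyDeriv F (shiftVar F n k))

/-! ### Operators of type `F`, functions, and the action of local diffeomorphisms -/

section Geometry

variable {n : ℕ} {M : Type*} [TopologicalSpace M] [ChartedSpace (EuclideanSpace ℝ (Fin n)) M]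

/-- A branch of the algebraic functions in `F` near the value `y` of `u`: an embedding of `F` into
the Laurent series in `t = u - y`, the identity on constants. -/
def IsBranchAt {F : Type*} [Field F] [Algebra (RatFunc ℝ) F] (y : ℝ)
    (ρ : F →+* LaurentSeries ℂ) : Prop :=
  (∀ c : ℝ, ρ (algebraMap (RatFunc ℝ) F (RatFunc.C c)) = HahnSeries.C (c : ℂ)) ∧
    ρ (algebraMap (RatFunc ℝ) F RatFunc.X) = HahnSeries.C (y : ℂ) + HahnSeries.single 1 1

/-- The function `g` of the variable `u` is, near `y`, an element of `F`: it is analytic, and its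
Taylor series is the expansion of some `w ∈ F` along the branch `ρ`. -/
def BelongsAt {F : Type*} [Field F] [Algebra (RatFunc ℝ) F] (y : ℝ)
    (ρ : F →+* LaurentSeries ℂ) (g : ℝ → ℝ) : Prop :=
  AnalyticAt ℝ g y ∧ ∃ w : F, ρ w = HahnSeries.ofPowerSeries ℤ ℂ
    (PowerSeries.mk fun m => ((iteratedDeriv m g y / (m.factorial : ℝ) : ℝ) : ℂ))

/-- `A` is, near `(b, y) ∈ J⁰(M) = M × ℝ`, a linear differential operator of order `≤ k` that
commutes with multiplication by `u` and is of type `F`: in local coordinates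
`(A g)(x,u) = ∑_{|σ| ≤ k} a_σ(x,u) ∂^σ g(x)` with smooth coefficients `a_σ`, and `a_σ(x,·) ∈ F` when
`x` is fixed. Such an operator is determined by its action `C^∞(M) → C^∞(M × ℝ)`, so it is given as
a map on functions `g` on `M`; the value `A g x u` stands for `(A g)(x,u)`. -/
def IsOperatorAt {F : Type*} [Field F] [Algebra (RatFunc ℝ) F] (k : ℕ) (b : M) (y : ℝ)
    (ρ : F →+* LaurentSeries ℂ) (A : (M → ℝ) → M → ℝ → ℝ) : Prop :=
  ∃ a : (Fin n → ℕ) → EuclideanSpace ℝ (Fin n) → ℝ → ℝ,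
    (∀ σ ∈ multiIndices n k,
      (∀ᶠ q : EuclideanSpace ℝ (Fin n) × ℝ in nhds (extChartAt (𝓡 n) b b, y),
        ContDiffAt ℝ ∞ (fun s : EuclideanSpace ℝ (Fin n) × ℝ => a σ s.1 s.2) q) ∧
      ∀ᶠ x in nhds (extChartAt (𝓡 n) b b), BelongsAt y ρ (a σ x)) ∧
    ∀ᶠ q : M × ℝ in nhds (b, y), ∀ g : M → ℝ, ContMDiffAt (𝓡 n) 𝓘(ℝ, ℝ) ∞ g q.1 →
      A g q.1 q.2 = ∑ σ ∈ multiIndices n k,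
        a σ (extChartAt (𝓡 n) b q.1) q.2 *
          multiD σ (g ∘ (extChartAt (𝓡 n) b).symm) (extChartAt (𝓡 n) b q.1)

/-- `f` is smooth near `b`. -/
def SmoothNear (b : M) (f : M → ℝ) : Prop :=
  ∀ᶠ z in nhds b, ContMDiffAt (𝓡 n) 𝓘(ℝ, ℝ) ∞ f z

/-- The function `(X - x)^σ / σ!` on `M`, where `X` are the local coordinates at `b`. -/
def chartMonomial (b : M) (x : EuclideanSpace ℝ (Fin n)) (σ : Fin n → ℕ) : M → ℝ :=
  fun z => ∏ i, (extChartAt (𝓡 n) b z i - x i) ^ σ i / ((σ i).factorial : ℝ)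

/-- The coefficient `a_σ(x,u)` of the operator `A` in the local coordinates at `b`, recovered as
the value of `A ((X - x)^σ / σ!)` at `(x,u)`. -/
def coeffAt (b : M) (A : (M → ℝ) → M → ℝ → ℝ) (σ : Fin n → ℕ)
    (x : EuclideanSpace ℝ (Fin n)) (u : ℝ) : ℝ :=
  A (chartMonomial b x σ) ((extChartAt (𝓡 n) b).symm x) u

/-- The jet coordinates of the related pair `([A]_{(b,y)}, [f]_b)`. -/
def jetOf (k : ℕ) (b : M) (y : ℝ) (A : (M → ℝ) → M → ℝ → ℝ) (f : M → ℝ) : JetVar n k → ℝ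
  | Sum.inl (σ, β, j) =>
      multiD β (fun x => iteratedDeriv j (coeffAt b A σ.1 x) y) (extChartAt (𝓡 n) b b)
  | Sum.inr γ => multiD γ.1 (f ∘ (extChartAt (𝓡 n) b).symm) (extChartAt (𝓡 n) b b)

/-- The image `φ⁽⁰⁾_* A` of an operator under `φ⁽⁰⁾ (x,u) = (φ x, u)`:
`(φ⁽⁰⁾_* A)(g) = A (g ∘ φ) ∘ (φ⁽⁰⁾)⁻¹`. -/
def pushOperator (φ : PartialDiffeomorph (𝓡 n) (𝓡 n) M M ∞) (A : (M → ℝ) → M → ℝ → ℝ) :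
    (M → ℝ) → M → ℝ → ℝ :=
  fun g x u => A (fun z => g (φ z)) (φ.symm x) u

/-- The image `φ_* f = f ∘ φ⁻¹` of a function. -/
def pushFunction (φ : PartialDiffeomorph (𝓡 n) (𝓡 n) M M ∞) (f : M → ℝ) : M → ℝ :=
  fun x => f (φ.symm x)

/-- The value of a polynomial in the jet coordinates at the point with coordinates `θ`. The
coefficients, which are functions of `u`, are kept as elements of `F`: the diffeomorphisms fix
`u`. -/
def evalJet {F : Type*} [Field F] [Algebra (RatFunc ℝ) F] {k : ℕ} (θ : JetVar n k → ℝ) :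
    JetPoly F n k →+* F :=
  MvPolynomial.eval fun v => algebraMap (RatFunc ℝ) F (RatFunc.C (θ v))

/-- `I` is invariant under the pseudogroup of local diffeomorphisms of `M`: for every local
diffeomorphism `φ` fixing the base point `b` and every related pair `(A, f)`, the function `I` takes
the same value on the jets of `(A, f)` and of `(φ⁽⁰⁾_* A, φ_* f)`, wherever both are defined. -/
def IsInvariant {F : Type*} [Field F] [Algebra (RatFunc ℝ) F] {k : ℕ} (b : M)
    (I : JetField F n k) : Prop :=
  ∀ P Q : JetPoly F n k, Q ≠ 0 →
    I = algebraMap (JetPoly F n k) (JetField F n k) P /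
      algebraMap (JetPoly F n k) (JetField F n k) Q →
  ∀ φ : PartialDiffeomorph (𝓡 n) (𝓡 n) M M ∞, b ∈ φ.source → φ b = b →
  ∀ (y : ℝ) (ρ : F →+* LaurentSeries ℂ), IsBranchAt y ρ →
  ∀ (A : (M → ℝ) → M → ℝ → ℝ) (f : M → ℝ), IsOperatorAt (n := n) k b y ρ A → SmoothNear (n := n) b f → f b = y →
    evalJet (jetOf k b y A f) Q ≠ 0 →
    evalJet (jetOf k b y (pushOperator φ A) (pushFunction φ f)) Q ≠ 0 →
    evalJet (jetOf k b y (pushOperator φ A) (pushFunction φ f)) P /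
        evalJet (jetOf k b y (pushOperator φ A) (pushFunction φ f)) Q =
      evalJet (jetOf k b y A f) P / evalJet (jetOf k b y A f) Q

/-- Invariants of related pairs: the elements of the field `ℱ(r)`. -/
def IsPairInvariant {F : Type*} [Field F] [Algebra (RatFunc ℝ) F] {k : ℕ} (b : M) (r : ℕ)
    (I : JetField F n k) : Prop :=
  I ∈ fieldQ F n k r ∧ IsInvariant b I

/-- Natural invariants of `F`-nonlinear differential operators: the invariant functions of the jets
of `A` alone, that is, the elements of the field `ℱ(0)`. -/
def IsNaturalInvariant {F : Type*} [Field F] [Algebra (RatFunc ℝ) F] {k : ℕ} (b : M)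
    (I : JetField F n k) : Prop :=
  IsPairInvariant b 0 I

end Geometry

/-! ### The ideal of relations and its reduced Groebner basis -/

/-- The ideal `𝒥 ⊆ 𝒬(0)[X₀, …, X_N]` of polynomial relations among `I, ∇I, …, ∇^N I`. -/
def relationIdeal [FiniteDimensional (RatFunc ℝ) F] (n k N : ℕ) (I : JetField F n k) :
    Ideal (MvPolynomial (Fin (N + 1)) (fieldQ F n k 0)) :=
  RingHom.ker (MvPolynomial.aeval (R := fieldQ F n k 0)
    fun i : Fin (N + 1) => (nabla F n k)^[(i : ℕ)] I)

/-- `B` is a reduced Groebner basis of the ideal `J` with respect to the monomial order `m`: a finite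
subset of `J` whose leading terms generate the ideal of leading terms of `J`, consisting of monic
polynomials such that no monomial of an element is divisible by the leading monomial of another
one. -/
structure IsReducedGroebnerBasis {s K : Type*} [Field K] (m : MonomialOrder s)
    (J : Ideal (MvPolynomial s K)) (B : Finset (MvPolynomial s K)) : Prop where
  subset : ∀ p ∈ B, p ∈ J
  span_leadingTerm :
    Ideal.span (m.leadingTerm '' (J : Set (MvPolynomial s K))) =
      Ideal.span (m.leadingTerm '' (B : Set (MvPolynomial s K)))
  monic : ∀ p ∈ B, m.leadingCoeff p = 1
  reduced : ∀ p ∈ B, ∀ q ∈ B, q ≠ p → ∀ d ∈ p.support, ¬ m.degree q ≤ d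

end RelatedPairs

end

/-!
The elements of `ℱ(r)` are the elements of the field of functions of jets that are fixed by the
pseudogroup of local diffeomorphisms. A local diffeomorphism `φ` fixing `b` acts on the jets of
related pairs by a linear substitution with real coefficients: by the chain rule the coordinates
`a_{σ,β,j}` of the image of an operator are combinations of the `a_{τ,δ,j}`, with coefficients
independent of `j` because `φ` does not move `u` (`exists_jetOf_push_inl`), and the `p_γ` of the
image of a function are combinations of the `p_δ` (`exists_jetOf_push_inr`). The substitution
commutes with `∇` and preserves `𝒬(0)` (`IsJetSubst.nabla_fieldSubst`,
`IsJetSubst.fieldSubst_mem`).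

Being an invariant is a condition on values at jets, and it amounts to being fixed by the induced
field endomorphisms (`IsInvariant.fieldSubst_eq`, `isInvariant_of_fieldSubst_eq`), since along any
branch of `F` the jets of related pairs are Zariski dense: operators and functions that are
polynomial in the local coordinates and in `u` realize every finite family of real jet coordinates
(`exists_isRelatedPairAt_jetOf_eq`, `eq_zero_of_evalJet_eq_zero`). Density also shows that the
substitutions are injective, the one of `φ⁻¹` being an inverse (`IsJetSubst.injective`).

An endomorphism that fixes `I₀` fixes all `∇^i I₀`, so it maps the ideal of relations into itself
(`map_fieldQSubst_mem_relationIdeal`). It therefore carries the reduced Groebner basis to a reduced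
Groebner basis of the same ideal, and uniqueness forces all coefficients to be fixed
(`IsReducedGroebnerBasis.map_coeff_eq`). Existence and uniqueness of the reduced Groebner basis hold
for every ideal and monomial order (`exists_isReducedGroebnerBasis`,
`IsReducedGroebnerBasis.unique`).
-/

noncomputable section

namespace RelatedPairs

open MvPolynomial
open scoped MonomialOrder

/-! ### Reduced Groebner bases over a field -/

section Groebner

variable {s K : Type*} [Field K] {m : MonomialOrder s} {J : Ideal (MvPolynomial s K)}

theorem span_leadingTerm_eq_of_monic {B : Finset (MvPolynomial s K)}
    (hB : ∀ p ∈ B, m.leadingCoeff p = 1) :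
    m.leadingTerm '' (B : Set (MvPolynomial s K)) =
      (fun d => monomial d (1 : K)) '' (m.degree '' (B : Set (MvPolynomial s K))) := by
  rw [Set.image_image]
  refine Set.image_congr fun p hp => ?_
  rw [MonomialOrder.leadingTerm, hB p hp]

theorem IsReducedGroebnerBasis.exists_degree_le {B : Finset (MvPolynomial s K)}
    (hB : IsReducedGroebnerBasis m J B) {p : MvPolynomial s K} (hp : p ∈ J) (hp0 : p ≠ 0) :
    ∃ q ∈ B, m.degree q ≤ m.degree p := by
  have h : m.leadingTerm p ∈ Ideal.span (m.leadingTerm '' (B : Set (MvPolynomial s K))) := by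
    rw [← hB.span_leadingTerm]
    exact Ideal.subset_span ⟨p, hp, rfl⟩
  rw [span_leadingTerm_eq_of_monic hB.monic, mem_ideal_span_monomial_image] at h
  obtain ⟨_, ⟨q, hq, rfl⟩, hle⟩ := h (m.degree p) (by
    rw [MonomialOrder.support_leadingTerm' hp0]; simp)
  exact ⟨q, hq, hle⟩

theorem IsReducedGroebnerBasis.ne_zero {B : Finset (MvPolynomial s K)}
    (hB : IsReducedGroebnerBasis m J B) {p : MvPolynomial s K} (hp : p ∈ B) : p ≠ 0 := by
  rintro rfl
  simpa using hB.monic 0 hp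

/-- A monomial of a member of a reduced Groebner basis that is divisible by the leading monomial of
some member is the leading monomial. -/
theorem IsReducedGroebnerBasis.eq_degree_of_degree_le {B : Finset (MvPolynomial s K)}
    (hB : IsReducedGroebnerBasis m J B) {p q : MvPolynomial s K} (hp : p ∈ B) (hq : q ∈ B)
    {d : s →₀ ℕ} (hd : d ∈ p.support) (hle : m.degree q ≤ d) : d = m.degree p := by
  have hqp : q = p := by
    by_contra hne
    exact hB.reduced p hp q hq hne d hd hle
  subst hqp
  exact m.toSyn.injective (le_antisymm (m.le_degree hd) (m.toSyn_monotone hle))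

/-- Members of two reduced Groebner bases of the same ideal with the same leading monomial agree:
their difference lies in the ideal, but no monomial of it other than the common leading one can be
divisible by a leading monomial. -/
theorem IsReducedGroebnerBasis.eq_of_degree_eq {B B' : Finset (MvPolynomial s K)}
    (hB : IsReducedGroebnerBasis m J B) (hB' : IsReducedGroebnerBasis m J B')
    {p q : MvPolynomial s K} (hp : p ∈ B) (hq : q ∈ B') (hpq : m.degree p = m.degree q) :
    p = q := by
  classical
  by_contra hne
  have h0 : p - q ≠ 0 := sub_ne_zero.mpr hne
  have hJ : p - q ∈ J := J.sub_mem (hB.subset p hp) (hB'.subset q hq)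
  have hmem : m.degree (p - q) ∈ (p - q).support := m.degree_mem_support h0
  have hdeg : m.degree (p - q) = m.degree p := by
    rcases Finset.mem_union.mp (MvPolynomial.support_sub s p q hmem) with h | h
    · obtain ⟨p', hp', hle⟩ := hB.exists_degree_le hJ h0
      exact hB.eq_degree_of_degree_le hp hp' h hle
    · obtain ⟨q', hq', hle⟩ := hB'.exists_degree_le hJ h0
      rw [hpq]
      exact hB'.eq_degree_of_degree_le hq hq' h hle
  rw [hdeg, mem_support_iff, coeff_sub] at hmem
  apply hmem
  have h1 : p.coeff (m.degree p) = 1 := hB.monic p hp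
  have h2 : q.coeff (m.degree q) = 1 := hB'.monic q hq
  rw [h1, hpq, h2, sub_self]

/-- The leading monomial of `p ∈ B` is divisible by that of some `q ∈ B'`, which is divisible by
that of some member of `B`; reducedness makes the latter `p` itself, so `p` and `q` have the same
leading monomial. -/
theorem IsReducedGroebnerBasis.subset_of {B B' : Finset (MvPolynomial s K)}
    (hB : IsReducedGroebnerBasis m J B) (hB' : IsReducedGroebnerBasis m J B') : B ⊆ B' := by
  intro p hp
  obtain ⟨q, hq, hqp⟩ := hB'.exists_degree_le (hB.subset p hp) (hB.ne_zero hp)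
  obtain ⟨p', hp', hp'q⟩ := hB.exists_degree_le (hB'.subset q hq) (hB'.ne_zero hq)
  have hp'p : p' = p := by
    by_contra hne
    exact hB.reduced p hp p' hp' hne _ (m.degree_mem_support (hB.ne_zero hp)) (hp'q.trans hqp)
  subst hp'p
  rw [hB.eq_of_degree_eq hB' hp hq (le_antisymm hp'q hqp)]
  exact hq

theorem IsReducedGroebnerBasis.unique {B B' : Finset (MvPolynomial s K)}
    (hB : IsReducedGroebnerBasis m J B) (hB' : IsReducedGroebnerBasis m J B') : B = B' :=
  Finset.Subset.antisymm (hB.subset_of hB') (hB'.subset_of hB)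

/-- The exponents of the leading monomials of the nonzero members of an ideal. -/
def leadingExponents (m : MonomialOrder s) (J : Ideal (MvPolynomial s K)) : Set (s →₀ ℕ) :=
  {d | ∃ p ∈ J, p ≠ 0 ∧ m.degree p = d}

/-- For each leading exponent `d` there is a member of the ideal of the form `X^d` plus monomials
that are not leading monomials: divide the lower terms of a monic member by the whole ideal. -/
theorem exists_reduced_of_mem_leadingExponents {d : s →₀ ℕ} (hd : d ∈ leadingExponents m J) :
    ∃ p ∈ J, m.degree p = d ∧ m.leadingCoeff p = 1 ∧
      ∀ e ∈ p.support, e ≠ d → e ∉ leadingExponents m J := by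
  classical
  obtain ⟨p, hpJ, hp0, rfl⟩ := hd
  have hlc : m.leadingCoeff p ≠ 0 := m.leadingCoeff_ne_zero_iff.mpr hp0
  obtain ⟨g, r, hgr, hg, hr⟩ := m.div_set (B := {q | q ∈ J ∧ q ≠ 0})
    (fun q hq => (m.leadingCoeff_ne_zero_iff.mpr hq.2).isUnit)
    (C (m.leadingCoeff p)⁻¹ * p - monomial (m.degree p) (1 : K))
  -- `f` is the monic multiple of `p` without its leading term, and `r` is its remainder
  set f := C (m.leadingCoeff p)⁻¹ * p - monomial (m.degree p) (1 : K) with hf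
  have hr' : ∀ e ∈ r.support, e ∉ leadingExponents m J := by
    rintro e he ⟨q, hq, hq0, rfl⟩
    exact hr _ he q ⟨hq, hq0⟩ le_rfl
  have hfr : f - r ∈ J := by
    rw [hgr, add_sub_cancel_right, Finsupp.linearCombination_apply]
    exact J.sum_mem fun q _ => J.mul_mem_left _ q.2.1
  have hfdeg : m.degree f ≼[m] m.degree p := by
    refine m.degree_sub_le.trans (sup_le ?_ (m.degree_monomial_le _))
    rw [← smul_eq_C_mul]
    exact m.degree_smul_le
  have hrdeg : m.degree r ≼[m] m.degree p := by
    have : r = f - Finsupp.linearCombination _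
        (fun b : {q | q ∈ J ∧ q ≠ 0} => (b : MvPolynomial s K)) g := by
      rw [hgr]; ring
    rw [this]
    refine m.degree_sub_le.trans (sup_le hfdeg ?_)
    rw [Finsupp.linearCombination_apply]
    refine m.degree_sum_le.trans (Finset.sup_le fun q _ => ?_)
    simp only [smul_eq_mul, mul_comm (g q)]
    exact (hg q).trans hfdeg
  have hdr : r.coeff (m.degree p) = 0 := by
    by_contra h
    exact hr' _ (mem_support_iff.mpr h) ⟨p, hpJ, hp0, rfl⟩
  have hcoeff : (monomial (m.degree p) (1 : K) + r).coeff (m.degree p) = 1 := by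
    simp [hdr]
  have hne : monomial (m.degree p) (1 : K) + r ≠ 0 := by
    intro h; rw [h] at hcoeff; simp at hcoeff
  have hdeg : m.degree (monomial (m.degree p) (1 : K) + r) = m.degree p := by
    apply m.toSyn.injective
    apply le_antisymm
    · exact m.degree_add_le.trans (sup_le (m.degree_monomial_le _) hrdeg)
    · exact m.le_degree (mem_support_iff.mpr (by rw [hcoeff]; exact one_ne_zero))
  refine ⟨monomial (m.degree p) 1 + r, ?_, hdeg, ?_, ?_⟩
  · have : monomial (m.degree p) (1 : K) + r = C (m.leadingCoeff p)⁻¹ * p - (f - r) := by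
      rw [hf]; ring
    rw [this]
    exact J.sub_mem (J.mul_mem_left _ hpJ) hfr
  · rw [MonomialOrder.leadingCoeff, hdeg, hcoeff]
  · intro e he hne
    apply hr'
    rw [mem_support_iff, coeff_add, coeff_monomial, if_neg (Ne.symm hne), zero_add] at he
    exact mem_support_iff.mpr he

/-- Existence: by Dickson's lemma there are finitely many minimal leading exponents, and each
contributes one element. -/
theorem exists_isReducedGroebnerBasis [Finite s] (m : MonomialOrder s)
    (J : Ideal (MvPolynomial s K)) :
    ∃ B : Finset (MvPolynomial s K), IsReducedGroebnerBasis m J B := by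
  classical
  set D := leadingExponents m J with hD
  choose! b hbJ hbdeg hblc hbred using
    fun d (hd : d ∈ D) => exists_reduced_of_mem_leadingExponents hd
  have hfin : {d | Minimal (· ∈ D) d}.Finite :=
    (setOfPred_minimal_antichain _).finite_of_wellQuasiOrdered wellQuasiOrdered_le
  have hsub : ∀ p ∈ hfin.toFinset.image b, ∃ d, Minimal (· ∈ D) d ∧ b d = p := by
    intro p hp
    simpa using hp
  refine ⟨hfin.toFinset.image b, ?_, ?_, ?_, ?_⟩
  · intro p hp
    obtain ⟨d, hd, rfl⟩ := hsub p hp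
    exact hbJ d hd.prop
  · apply le_antisymm
    · rw [Ideal.span_le]
      rintro _ ⟨p, hp, rfl⟩
      rcases eq_or_ne p 0 with rfl | hp0
      · simp
      rw [span_leadingTerm_eq_of_monic (by
        intro q hq
        obtain ⟨d, hd, rfl⟩ := hsub q hq
        exact hblc d hd.prop), SetLike.mem_coe, mem_ideal_span_monomial_image]
      intro e he
      rw [MonomialOrder.support_leadingTerm' hp0, Finset.mem_singleton] at he
      subst he
      obtain ⟨d, hdle, hd⟩ := exists_minimal_le_of_wellFoundedLT (· ∈ D) (m.degree p)
        ⟨p, hp, hp0, rfl⟩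
      refine ⟨d, ⟨b d, ?_, hbdeg d hd.prop⟩, hdle⟩
      simp only [Finset.coe_image, Set.Finite.coe_toFinset]
      exact ⟨d, hd, rfl⟩
    · apply Ideal.span_mono
      apply Set.image_mono
      intro p hp
      obtain ⟨d, hd, rfl⟩ := hsub p hp
      exact hbJ d hd.prop
  · intro p hp
    obtain ⟨d, hd, rfl⟩ := hsub p hp
    exact hblc d hd.prop
  · intro p hp q hq hqp e he hle
    obtain ⟨d, hd, rfl⟩ := hsub p hp
    obtain ⟨d', hd', rfl⟩ := hsub q hq
    rw [hbdeg d' hd'.prop] at hle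
    rcases eq_or_ne e d with rfl | hed
    · exact hqp (by rw [hd.eq_of_le hd'.prop hle])
    · apply hbred d hd.prop e he hed
      -- `e` is a multiple of the leading exponent `d'`, hence itself a leading exponent
      have hb0 : b d' ≠ 0 := by
        intro h
        have := hblc d' hd'.prop
        rw [h] at this
        simp at this
      have hm0 : (monomial (e - d') (1 : K)) ≠ 0 := by simp
      refine ⟨monomial (e - d') 1 * b d', J.mul_mem_left _ (hbJ d' hd'.prop),
        mul_ne_zero hm0 hb0, ?_⟩
      rw [m.degree_mul hm0 hb0, m.degree_monomial, if_neg one_ne_zero, hbdeg d' hd'.prop,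
        tsub_add_cancel_of_le hle]

/-- An endomorphism of the coefficient field that maps an ideal into itself carries the reduced
Groebner basis to a reduced Groebner basis, hence fixes all its coefficients. -/
theorem IsReducedGroebnerBasis.map_coeff_eq {B : Finset (MvPolynomial s K)}
    (hB : IsReducedGroebnerBasis m J B) (φ : K →+* K)
    (hφ : ∀ p ∈ J, MvPolynomial.map φ p ∈ J) {p : MvPolynomial s K} (hp : p ∈ B) (d : s →₀ ℕ) :
    φ (p.coeff d) = p.coeff d := by
  classical
  have hsupp : ∀ q : MvPolynomial s K, (MvPolynomial.map φ q).support = q.support := fun q =>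
    MvPolynomial.support_map_of_injective q φ.injective
  have hdeg : ∀ q : MvPolynomial s K, m.degree (MvPolynomial.map φ q) = m.degree q := by
    intro q
    simp only [MonomialOrder.degree, hsupp]
  have hmonic : ∀ q ∈ B.image (MvPolynomial.map φ), m.leadingCoeff q = 1 := by
    intro q hq
    obtain ⟨p, hp, rfl⟩ := Finset.mem_image.mp hq
    rw [MonomialOrder.leadingCoeff, hdeg, coeff_map, ← MonomialOrder.leadingCoeff, hB.monic p hp,
      map_one]
  have hB' : IsReducedGroebnerBasis m J (B.image (MvPolynomial.map φ)) := by
    refine ⟨?_, ?_, hmonic, ?_⟩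
    · intro q hq
      obtain ⟨p, hp, rfl⟩ := Finset.mem_image.mp hq
      exact hφ p (hB.subset p hp)
    · rw [hB.span_leadingTerm, span_leadingTerm_eq_of_monic hmonic,
        span_leadingTerm_eq_of_monic hB.monic]
      congr 2
      ext e
      simp [hdeg]
    · intro q hq q' hq' hne e he hle
      obtain ⟨p, hp, rfl⟩ := Finset.mem_image.mp hq
      obtain ⟨p', hp', rfl⟩ := Finset.mem_image.mp hq'
      rw [hsupp] at he
      rw [hdeg] at hle
      exact hB.reduced p hp p' hp' (fun h => hne (by rw [h])) e he hle
  have h := hB'.eq_of_degree_eq hB (Finset.mem_image_of_mem _ hp) hp (hdeg p)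
  rw [← coeff_map, h]

end Groebner

/-! ### Calculus of iterated partial derivatives -/

section Calculus

variable {n : ℕ}

/-- The iterated partial derivative along a word of directions, outermost direction first. -/
def wordD (l : List (Fin n)) (f : EuclideanSpace ℝ (Fin n) → ℝ) : EuclideanSpace ℝ (Fin n) → ℝ :=
  l.foldr partialD f

/-- The word `0…0 1…1 …` with `σ i` letters `i`. -/
def multiWord (σ : Fin n → ℕ) : List (Fin n) :=
  (List.finRange n).flatMap fun i => List.replicate (σ i) i

theorem multiD_eq_wordD (σ : Fin n → ℕ) (f : EuclideanSpace ℝ (Fin n) → ℝ) :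
    multiD σ f = wordD (multiWord σ) f := by
  unfold multiD wordD multiWord
  generalize List.finRange n = l
  induction l with
  | nil => rfl
  | cons a l ih =>
    rw [List.foldr_cons, List.flatMap_cons, List.foldr_append, ih]
    generalize List.foldr partialD f (List.flatMap _ l) = g
    generalize σ a = k
    induction k with
    | zero => rfl
    | succ k ih => rw [Function.iterate_succ_apply', List.replicate_succ, List.foldr_cons, ih]

theorem count_multiWord (σ : Fin n → ℕ) (i : Fin n) : (multiWord σ).count i = σ i := by
  unfold multiWord
  rw [List.count_flatMap, ← List.ofFn_eq_map, List.sum_ofFn]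
  simp [List.count_replicate]

theorem length_multiWord (σ : Fin n → ℕ) : (multiWord σ).length = ∑ i, σ i := by
  unfold multiWord
  rw [List.length_flatMap, ← List.ofFn_eq_map, List.sum_ofFn]
  simp

theorem multiWord_add_single_perm (σ : Fin n → ℕ) (i : Fin n) :
    (multiWord (σ + Pi.single i 1)).Perm (i :: multiWord σ) := by
  rw [List.perm_iff_count]
  intro j
  rw [count_multiWord, List.count_cons, count_multiWord]
  by_cases h : i = j
  · subst h; simp
  · simp [h, Ne.symm h]

theorem sum_add_single (σ : Fin n → ℕ) (i : Fin n) :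
    ∑ j, (σ + Pi.single i 1 : Fin n → ℕ) j = ∑ j, σ j + 1 := by
  simp [Finset.sum_add_distrib]

theorem exists_eq_add_single {σ : Fin n → ℕ} (h : σ ≠ 0) :
    ∃ (i : Fin n) (τ : Fin n → ℕ), σ = τ + Pi.single i 1 := by
  obtain ⟨i, hi⟩ := Function.ne_iff.mp h
  refine ⟨i, σ - Pi.single i 1, ?_⟩
  rw [tsub_add_cancel_of_le]
  intro j
  by_cases hj : j = i
  · subst hj
    simpa using Nat.one_le_iff_ne_zero.mpr hi
  · simp [hj]

theorem contDiffAt_partialD {m : ℕ∞ω} {f : EuclideanSpace ℝ (Fin n) → ℝ}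
    {x : EuclideanSpace ℝ (Fin n)} (i : Fin n) (hf : ContDiffAt ℝ (m + 1) f x) :
    ContDiffAt ℝ m (partialD i f) x :=
  (hf.fderiv_right le_rfl).clm_apply contDiffAt_const

theorem contDiffAt_wordD {m : ℕ∞ω} {f : EuclideanSpace ℝ (Fin n) → ℝ}
    {x : EuclideanSpace ℝ (Fin n)} (l : List (Fin n)) (hf : ContDiffAt ℝ (m + l.length) f x) :
    ContDiffAt ℝ m (wordD l f) x := by
  induction l generalizing m with
  | nil => simpa [wordD] using hf
  | cons a l ih =>
    apply contDiffAt_partialD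
    apply ih
    convert hf using 1
    rw [List.length_cons]
    push_cast
    rw [add_assoc, add_comm (1 : ℕ∞ω)]

theorem partialD_congr {f g : EuclideanSpace ℝ (Fin n) → ℝ} {x : EuclideanSpace ℝ (Fin n)}
    (i : Fin n) (h : f =ᶠ[nhds x] g) : partialD i f =ᶠ[nhds x] partialD i g :=
  (h.fderiv (𝕜 := ℝ)).mono fun y hy => by simp only [partialD, hy]

theorem wordD_congr {f g : EuclideanSpace ℝ (Fin n) → ℝ} {x : EuclideanSpace ℝ (Fin n)}
    (l : List (Fin n)) (h : f =ᶠ[nhds x] g) : wordD l f =ᶠ[nhds x] wordD l g := by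
  induction l with
  | nil => exact h
  | cons a l ih => exact partialD_congr a ih

theorem multiD_congr {f g : EuclideanSpace ℝ (Fin n) → ℝ} {x : EuclideanSpace ℝ (Fin n)}
    (σ : Fin n → ℕ) (h : f =ᶠ[nhds x] g) : multiD σ f x = multiD σ g x := by
  rw [multiD_eq_wordD, multiD_eq_wordD]
  exact (wordD_congr _ h).eq_of_nhds

theorem partialD_comm {f : EuclideanSpace ℝ (Fin n) → ℝ} {x : EuclideanSpace ℝ (Fin n)}
    (i j : Fin n) (hf : ContDiffAt ℝ 2 f x) :
    partialD i (partialD j f) x = partialD j (partialD i f) x := by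
  have hd : DifferentiableAt ℝ (fderiv ℝ f) x :=
    (hf.fderiv_right (m := 1) (by norm_num)).differentiableAt (by norm_num)
  have key : ∀ v w, fderiv ℝ (fun y => fderiv ℝ f y v) x w = fderiv ℝ (fderiv ℝ f) x w v := by
    intro v w
    rw [fderiv_clm_apply hd (differentiableAt_const v)]
    simp
  unfold partialD
  rw [key, key]
  exact (hf.isSymmSndFDerivAt (by simp)) _ _

theorem wordD_perm {l l' : List (Fin n)} (hl : l.Perm l') {f : EuclideanSpace ℝ (Fin n) → ℝ}
    {x : EuclideanSpace ℝ (Fin n)} (hf : ContDiffAt ℝ l.length f x) :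
    wordD l f x = wordD l' f x := by
  induction hl generalizing x with
  | nil => rfl
  | @cons a l₁ l₂ hl ih =>
    refine (partialD_congr a ?_).eq_of_nhds
    filter_upwards [hf.eventually (by simp)] with y hy
    exact ih (hy.of_le (by simp))
  | swap a b l =>
    apply partialD_comm
    apply contDiffAt_wordD
    convert hf using 1
    simp only [List.length_cons]
    push_cast
    rw [add_assoc, one_add_one_eq_two, add_comm]
  | trans h₁ _ ih₁ ih₂ =>
    rw [ih₁ hf]
    exact ih₂ (by rwa [← h₁.length_eq])

/-- Because partial derivatives commute, raising one entry of the multi-index is one more outer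
derivative. -/
theorem multiD_add_single (σ : Fin n → ℕ) (i : Fin n) {f : EuclideanSpace ℝ (Fin n) → ℝ}
    {x : EuclideanSpace ℝ (Fin n)} (hf : ContDiffAt ℝ ((∑ j, σ j + 1 : ℕ) : ℕ∞ω) f x) :
    multiD (σ + Pi.single i 1) f x = partialD i (multiD σ f) x := by
  rw [multiD_eq_wordD, multiD_eq_wordD, wordD_perm (multiWord_add_single_perm σ i)]
  · rfl
  · rwa [length_multiWord, sum_add_single]

theorem multiD_add_single' (σ : Fin n → ℕ) (i : Fin n) {f : EuclideanSpace ℝ (Fin n) → ℝ}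
    {x : EuclideanSpace ℝ (Fin n)} (hf : ContDiffAt ℝ ((∑ j, σ j + 1 : ℕ) : ℕ∞ω) f x) :
    multiD (σ + Pi.single i 1) f x = multiD σ (partialD i f) x := by
  rw [multiD_eq_wordD, multiD_eq_wordD,
    wordD_perm ((multiWord_add_single_perm σ i).trans (List.perm_append_singleton _ _).symm)]
  · simp [wordD]
  · rwa [length_multiWord, sum_add_single]

@[simp] theorem multiD_zero (f : EuclideanSpace ℝ (Fin n) → ℝ) : multiD 0 f = f := by
  rw [multiD_eq_wordD]
  have : multiWord (0 : Fin n → ℕ) = [] := by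
    rw [← List.length_eq_zero_iff, length_multiWord]; simp
  rw [this]; rfl

theorem contDiffAt_multiD {m : ℕ∞ω} {f : EuclideanSpace ℝ (Fin n) → ℝ}
    {x : EuclideanSpace ℝ (Fin n)} (σ : Fin n → ℕ)
    (hf : ContDiffAt ℝ (m + (∑ j, σ j : ℕ)) f x) :
    ContDiffAt ℝ m (multiD σ f) x := by
  rw [multiD_eq_wordD]
  apply contDiffAt_wordD
  rwa [length_multiWord]

theorem partialD_mul {f g : EuclideanSpace ℝ (Fin n) → ℝ} {x : EuclideanSpace ℝ (Fin n)}
    (i : Fin n) (hf : DifferentiableAt ℝ f x) (hg : DifferentiableAt ℝ g x) :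
    partialD i (fun y => f y * g y) x = partialD i f x * g x + f x * partialD i g x := by
  unfold partialD
  rw [fderiv_fun_mul hf hg]
  simp
  ring

theorem partialD_sum {ι : Type*} {s : Finset ι} {f : ι → EuclideanSpace ℝ (Fin n) → ℝ}
    {x : EuclideanSpace ℝ (Fin n)} (i : Fin n) (hf : ∀ a ∈ s, DifferentiableAt ℝ (f a) x) :
    partialD i (fun y => ∑ a ∈ s, f a y) x = ∑ a ∈ s, partialD i (f a) x := by
  unfold partialD
  rw [fderiv_fun_sum hf]
  simp

theorem partialD_comp {h : EuclideanSpace ℝ (Fin n) → ℝ}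
    {ψ : EuclideanSpace ℝ (Fin n) → EuclideanSpace ℝ (Fin n)} {x : EuclideanSpace ℝ (Fin n)}
    (i : Fin n) (hh : DifferentiableAt ℝ h (ψ x)) (hψ : DifferentiableAt ℝ ψ x) :
    partialD i (fun y => h (ψ y)) x =
      ∑ l, partialD i (fun y => ψ y l) x * partialD l h (ψ x) := by
  unfold partialD
  have h1 : ∀ l, fderiv ℝ (fun y => ψ y l) x (EuclideanSpace.single i 1) =
      (fderiv ℝ ψ x (EuclideanSpace.single i 1)) l := by
    intro l
    have := ((EuclideanSpace.proj l : EuclideanSpace ℝ (Fin n) →L[ℝ] ℝ).hasFDerivAt.comp x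
      hψ.hasFDerivAt).fderiv
    exact congrArg (fun T => T (EuclideanSpace.single i 1)) this
  have h2 : fderiv ℝ (fun y => h (ψ y)) x = (fderiv ℝ h (ψ x)).comp (fderiv ℝ ψ x) :=
    fderiv_comp x hh hψ
  rw [h2, ContinuousLinearMap.comp_apply]
  set v := fderiv ℝ ψ x (EuclideanSpace.single i 1) with hv
  have hsum : v = ∑ l, v l • EuclideanSpace.single l (1 : ℝ) := by
    ext j
    simp [Pi.single_apply]
  conv_lhs => rw [hsum]
  rw [map_sum]
  refine Finset.sum_congr rfl fun l _ => ?_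
  rw [map_smul, smul_eq_mul, h1]

/-! ### Derivatives of composites -/

/-- The operation `T` on functions, taking `h` near `ψ U` to a function on `U`, is given by a
differential operator of order at most `m` with smooth coefficients followed by pullback along `ψ`.
Only as much smoothness of `h` is required as is needed to differentiate it. -/
def IsPullbackOperator (U : Set (EuclideanSpace ℝ (Fin n)))
    (ψ : EuclideanSpace ℝ (Fin n) → EuclideanSpace ℝ (Fin n)) (m : ℕ)
    (T : (EuclideanSpace ℝ (Fin n) → ℝ) → EuclideanSpace ℝ (Fin n) → ℝ) : Prop :=
  ∃ Λ : (Fin n → ℕ) → EuclideanSpace ℝ (Fin n) → ℝ, (∀ γ, ContDiffOn ℝ ∞ (Λ γ) U) ∧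
    ∀ x ∈ U, ∀ h, ContDiffAt ℝ m h (ψ x) →
      T h x = ∑ γ ∈ multiIndices n m, Λ γ x * multiD γ h (ψ x)

namespace IsPullbackOperator

variable {U : Set (EuclideanSpace ℝ (Fin n))}
  {ψ : EuclideanSpace ℝ (Fin n) → EuclideanSpace ℝ (Fin n)} {m : ℕ}

theorem congr {T T' : (EuclideanSpace ℝ (Fin n) → ℝ) → EuclideanSpace ℝ (Fin n) → ℝ}
    (hT : IsPullbackOperator U ψ m T)
    (h : ∀ x ∈ U, ∀ h, ContDiffAt ℝ m h (ψ x) → T' h x = T h x) :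
    IsPullbackOperator U ψ m T' := by
  obtain ⟨Λ, hΛ, hT⟩ := hT
  exact ⟨Λ, hΛ, fun x hx g hg => (h x hx g hg).trans (hT x hx g hg)⟩

/-- A smooth multiple of a partial derivative of order at most `m`. -/
theorem of_multiD {c : EuclideanSpace ℝ (Fin n) → ℝ} (hc : ContDiffOn ℝ ∞ c U)
    {γ : Fin n → ℕ} (hγ : ∑ i, γ i ≤ m) :
    IsPullbackOperator U ψ m (fun h x => c x * multiD γ h (ψ x)) := by
  classical
  refine ⟨fun γ' => if γ' = γ then c else 0, fun γ' => ?_, fun x hx h hh => ?_⟩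
  · dsimp only
    split_ifs
    · exact hc
    · exact contDiffOn_const
  · rw [Finset.sum_eq_single_of_mem γ (mem_multiIndices.mpr hγ)]
    · simp
    · intro γ' _ hne
      simp [hne]

theorem sum {ι : Type*} {s : Finset ι}
    {T : ι → (EuclideanSpace ℝ (Fin n) → ℝ) → EuclideanSpace ℝ (Fin n) → ℝ}
    (hT : ∀ a ∈ s, IsPullbackOperator U ψ m (T a)) :
    IsPullbackOperator U ψ m (fun h x => ∑ a ∈ s, T a h x) := by
  choose! Λ hΛ hT using hT
  refine ⟨fun γ x => ∑ a ∈ s, Λ a γ x, fun γ => ContDiffOn.sum fun a ha => hΛ a ha γ,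
    fun x hx h hh => ?_⟩
  simp only [Finset.sum_mul]
  rw [Finset.sum_comm]
  exact Finset.sum_congr rfl fun a ha => hT a ha x hx h hh

theorem add {T T' : (EuclideanSpace ℝ (Fin n) → ℝ) → EuclideanSpace ℝ (Fin n) → ℝ}
    (hT : IsPullbackOperator U ψ m T) (hT' : IsPullbackOperator U ψ m T') :
    IsPullbackOperator U ψ m (fun h x => T h x + T' h x) := by
  obtain ⟨Λ, hΛ, hT⟩ := hT
  obtain ⟨Λ', hΛ', hT'⟩ := hT'
  refine ⟨fun γ x => Λ γ x + Λ' γ x, fun γ => (hΛ γ).add (hΛ' γ), fun x hx h hh => ?_⟩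
  simp only [add_mul, Finset.sum_add_distrib]
  rw [hT x hx h hh, hT' x hx h hh]

theorem mono {T : (EuclideanSpace ℝ (Fin n) → ℝ) → EuclideanSpace ℝ (Fin n) → ℝ}
    (hT : IsPullbackOperator U ψ m T) {m' : ℕ} (hm : m ≤ m') : IsPullbackOperator U ψ m' T := by
  obtain ⟨Λ, hΛ, hT⟩ := hT
  exact (sum fun γ hγ => of_multiD (hΛ γ) ((mem_multiIndices.mp hγ).trans hm)).congr
    fun x hx h hh => hT x hx h (hh.of_le (by exact_mod_cast hm))

/-- The chain and product rules. -/
theorem partialD {T : (EuclideanSpace ℝ (Fin n) → ℝ) → EuclideanSpace ℝ (Fin n) → ℝ}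
    (hT : IsPullbackOperator U ψ m T) (hU : IsOpen U) (hψ : ContDiffOn ℝ ∞ ψ U) (i : Fin n) :
    IsPullbackOperator U ψ (m + 1) (fun h => RelatedPairs.partialD i (T h)) := by
  obtain ⟨Λ, hΛ, hT⟩ := hT
  have hsm : ∀ {g : EuclideanSpace ℝ (Fin n) → ℝ}, ContDiffOn ℝ ∞ g U →
      ContDiffOn ℝ ∞ (RelatedPairs.partialD i g) U := fun hg x hx =>
    (contDiffAt_partialD i ((hg.contDiffAt (hU.mem_nhds hx)).of_le (by simp))).contDiffWithinAt
  have hψl : ∀ l, ContDiffOn ℝ ∞ (fun y => ψ y l) U := fun l =>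
    (contDiffOn_euclidean.mp hψ) l
  have key : IsPullbackOperator U ψ (m + 1) (fun h x => ∑ γ ∈ multiIndices n m,
      (RelatedPairs.partialD i (Λ γ) x * multiD γ h (ψ x) +
        ∑ l, (Λ γ x * RelatedPairs.partialD i (fun y => ψ y l) x) *
          multiD (γ + Pi.single l 1) h (ψ x))) := by
    refine sum fun γ hγ => add (of_multiD (hsm (hΛ γ)) ?_) (sum fun l _ => of_multiD ?_ ?_)
    · exact (mem_multiIndices.mp hγ).trans (Nat.le_succ m)
    · exact (hΛ γ).mul (hsm (hψl l))
    · rw [sum_add_single]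
      exact Nat.succ_le_succ (mem_multiIndices.mp hγ)
  refine key.congr fun x hx h hh => ?_
  have hψx : ContDiffAt ℝ ∞ ψ x := hψ.contDiffAt (hU.mem_nhds hx)
  have hev : T h =ᶠ[nhds x] fun y => ∑ γ ∈ multiIndices n m, Λ γ y * multiD γ h (ψ y) := by
    filter_upwards [hU.mem_nhds hx,
      hψx.continuousAt.eventually (hh.eventually (by simp))] with y hy hhy
    exact hT y hy h (hhy.of_le (by simp))
  rw [(partialD_congr i hev).eq_of_nhds]
  have hdΛ : ∀ γ, DifferentiableAt ℝ (Λ γ) x := fun γ =>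
    ((hΛ γ).contDiffAt (hU.mem_nhds hx)).differentiableAt (by simp)
  have hdψ : DifferentiableAt ℝ ψ x := hψx.differentiableAt (by simp)
  have hdh : ∀ γ ∈ multiIndices n m, DifferentiableAt ℝ (multiD γ h) (ψ x) := fun γ hγ => by
    refine (contDiffAt_multiD (m := 1) γ (hh.of_le ?_)).differentiableAt (by simp)
    have := mem_multiIndices.mp hγ
    exact_mod_cast (by omega : 1 + ∑ j, γ j ≤ m + 1)
  have hdc : ∀ γ ∈ multiIndices n m, DifferentiableAt ℝ (fun y => multiD γ h (ψ y)) x :=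
    fun γ hγ => (hdh γ hγ).comp x hdψ
  rw [partialD_sum (f := fun γ y => Λ γ y * multiD γ h (ψ y)) i
    fun γ hγ => (hdΛ γ).mul (hdc γ hγ)]
  refine Finset.sum_congr rfl fun γ hγ => ?_
  rw [partialD_mul i (hdΛ γ) (hdc γ hγ), partialD_comp i (hdh γ hγ) hdψ, Finset.mul_sum]
  congr 1
  refine Finset.sum_congr rfl fun l _ => ?_
  rw [multiD_add_single γ l (hh.of_le ?_), mul_assoc]
  have := mem_multiIndices.mp hγ
  exact_mod_cast (by omega : ∑ j, γ j + 1 ≤ m + 1)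

end IsPullbackOperator

/-- The partial derivatives of `c · (h ∘ ψ)` are combinations, with smooth coefficients independent
of `h`, of the pullbacks of the partial derivatives of `h` of at most the same order. -/
theorem isPullbackOperator_multiD {U : Set (EuclideanSpace ℝ (Fin n))} (hU : IsOpen U)
    {ψ : EuclideanSpace ℝ (Fin n) → EuclideanSpace ℝ (Fin n)} (hψ : ContDiffOn ℝ ∞ ψ U)
    {c : EuclideanSpace ℝ (Fin n) → ℝ} (hc : ContDiffOn ℝ ∞ c U) {m : ℕ} {β : Fin n → ℕ}
    (hβ : ∑ i, β i = m) :
    IsPullbackOperator U ψ m (fun h => multiD β (fun y => c y * h (ψ y))) := by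
  induction m generalizing β with
  | zero =>
    obtain rfl : β = 0 := by
      ext i
      simpa using (Finset.sum_eq_zero_iff.mp hβ) i (Finset.mem_univ i)
    have := IsPullbackOperator.of_multiD (ψ := ψ) (m := 0) hc (γ := 0) (by simp)
    simpa using this
  | succ m ih =>
    have hβ0 : β ≠ 0 := by
      rintro rfl
      simp at hβ
    obtain ⟨i, τ, rfl⟩ := exists_eq_add_single hβ0
    rw [sum_add_single] at hβ
    have hτ : ∑ j, τ j = m := by omega
    refine ((ih hτ).partialD hU hψ i).congr fun x hx h hh => ?_
    apply multiD_add_single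
    rw [hτ]
    exact (((hc.contDiffAt (hU.mem_nhds hx)).of_le (by exact_mod_cast le_top))).mul
      (hh.comp x ((hψ.contDiffAt (hU.mem_nhds hx)).of_le (by exact_mod_cast le_top)))

/-! ### Taylor monomials -/

/-- The Taylor monomial `(x - x₀)^γ / γ!`. -/
def taylorMonomial (x₀ : EuclideanSpace ℝ (Fin n)) (γ : Fin n → ℕ) :
    EuclideanSpace ℝ (Fin n) → ℝ :=
  fun x => ∏ i, (x i - x₀ i) ^ γ i / ((γ i).factorial : ℝ)

theorem contDiff_taylorMonomial (x₀ : EuclideanSpace ℝ (Fin n)) (γ : Fin n → ℕ) {m : ℕ∞ω} :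
    ContDiff ℝ m (taylorMonomial x₀ γ) := by
  unfold taylorMonomial
  fun_prop

theorem hasDerivAt_pow_div_factorial (y : ℝ) (k : ℕ) (u : ℝ) :
    HasDerivAt (fun u : ℝ => (u - y) ^ (k + 1) / ((k + 1).factorial : ℝ))
      ((u - y) ^ k / (k.factorial : ℝ)) u := by
  have h := ((((hasDerivAt_id u).sub_const y).pow (k + 1)).div_const ((k + 1).factorial : ℝ))
  refine h.congr_deriv ?_
  rw [Nat.factorial_succ]
  have : ((k.factorial : ℕ) : ℝ) ≠ 0 := by positivity
  push_cast
  field_simp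
  simp

theorem partialD_eq_deriv {f : EuclideanSpace ℝ (Fin n) → ℝ} {x : EuclideanSpace ℝ (Fin n)}
    (i : Fin n) (hf : DifferentiableAt ℝ f x) :
    partialD i f x = deriv (fun t : ℝ => f (x + t • EuclideanSpace.single i 1)) 0 := by
  unfold partialD
  rw [← hf.lineDeriv_eq_fderiv]
  rfl

theorem taylorMonomial_line (x₀ x : EuclideanSpace ℝ (Fin n)) (γ : Fin n → ℕ) (i : Fin n) (t : ℝ) :
    taylorMonomial x₀ γ (x + t • EuclideanSpace.single i 1) =
      (t - (x₀ i - x i)) ^ γ i / ((γ i).factorial : ℝ) *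
        ∏ j ∈ Finset.univ.erase i, (x j - x₀ j) ^ γ j / ((γ j).factorial : ℝ) := by
  unfold taylorMonomial
  rw [← Finset.mul_prod_erase _ _ (Finset.mem_univ i)]
  congr 1
  · simp
    ring
  · refine Finset.prod_congr rfl fun j hj => ?_
    simp [Finset.ne_of_mem_erase hj]

theorem partialD_taylorMonomial_add_single (x₀ : EuclideanSpace ℝ (Fin n)) (γ : Fin n → ℕ)
    (i : Fin n) : partialD i (taylorMonomial x₀ (γ + Pi.single i 1)) = taylorMonomial x₀ γ := by
  ext x
  rw [partialD_eq_deriv i ((contDiff_taylorMonomial x₀ _ (m := 1)).differentiable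
    (by simp)).differentiableAt]
  simp only [taylorMonomial_line, Pi.add_apply, Pi.single_eq_same]
  rw [((hasDerivAt_pow_div_factorial (x₀ i - x i) (γ i) 0).mul_const _).deriv]
  unfold taylorMonomial
  rw [← Finset.mul_prod_erase _ _ (Finset.mem_univ i)]
  congr 1
  · simp
  · refine Finset.prod_congr rfl fun j hj => ?_
    simp [Finset.ne_of_mem_erase hj]

theorem partialD_taylorMonomial_of_eq_zero (x₀ : EuclideanSpace ℝ (Fin n)) {γ : Fin n → ℕ}
    {i : Fin n} (hi : γ i = 0) : partialD i (taylorMonomial x₀ γ) = 0 := by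
  ext x
  rw [partialD_eq_deriv i ((contDiff_taylorMonomial x₀ _ (m := 1)).differentiable
    (by simp)).differentiableAt]
  simp only [taylorMonomial_line, hi]
  simp

theorem multiD_zero_fun (σ : Fin n → ℕ) :
    multiD σ (0 : EuclideanSpace ℝ (Fin n) → ℝ) = 0 := by
  rw [multiD_eq_wordD]
  induction multiWord σ with
  | nil => rfl
  | cons a l ih =>
    change partialD a (wordD l 0) = 0
    rw [ih]
    ext x
    simp [partialD]

/-- The Taylor monomials are dual to the partial derivatives at the centre. -/
theorem multiD_taylorMonomial (x₀ : EuclideanSpace ℝ (Fin n)) (σ γ : Fin n → ℕ) :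
    multiD σ (taylorMonomial x₀ γ) x₀ = if γ = σ then 1 else 0 := by
  induction hm : ∑ i, σ i generalizing σ γ with
  | zero =>
    obtain rfl : σ = 0 := by
      ext i
      simpa using (Finset.sum_eq_zero_iff.mp hm) i (Finset.mem_univ i)
    rw [multiD_zero]
    split_ifs with h
    · subst h
      simp [taylorMonomial]
    · obtain ⟨i, hi⟩ := Function.ne_iff.mp h
      unfold taylorMonomial
      apply Finset.prod_eq_zero (Finset.mem_univ i)
      simpa [Nat.factorial_ne_zero] using hi
  | succ m ih =>
    have hσ0 : σ ≠ 0 := by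
      rintro rfl
      simp at hm
    obtain ⟨i, τ, rfl⟩ := exists_eq_add_single hσ0
    rw [sum_add_single] at hm
    rw [multiD_add_single' _ _ (contDiff_taylorMonomial x₀ γ).contDiffAt]
    by_cases hγ : γ i = 0
    · rw [partialD_taylorMonomial_of_eq_zero x₀ hγ, multiD_zero_fun, if_neg]
      · rfl
      · intro h
        rw [h] at hγ
        simp at hγ
    · obtain ⟨γ', rfl⟩ : ∃ γ', γ = γ' + Pi.single i 1 := by
        refine ⟨γ - Pi.single i 1, (tsub_add_cancel_of_le ?_).symm⟩
        intro j
        by_cases hj : j = i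
        · subst hj
          simpa using Nat.one_le_iff_ne_zero.mpr hγ
        · simp [hj]
      rw [partialD_taylorMonomial_add_single, ih τ γ' (by omega)]
      simp

theorem multiD_sum_smul {ι : Type*} {s : Finset ι} {f : ι → EuclideanSpace ℝ (Fin n) → ℝ}
    {x : EuclideanSpace ℝ (Fin n)} (σ : Fin n → ℕ) (c : ι → ℝ)
    (hf : ∀ a ∈ s, ContDiffAt ℝ (∑ i, σ i : ℕ) (f a) x) :
    multiD σ (fun y => ∑ a ∈ s, c a * f a y) x = ∑ a ∈ s, c a * multiD σ (f a) x := by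
  simp only [multiD_eq_wordD]
  rw [← length_multiWord] at hf
  generalize multiWord σ = l at hf ⊢
  induction l generalizing x with
  | nil => rfl
  | cons i l ih =>
    have hev : wordD l (fun y => ∑ a ∈ s, c a * f a y) =ᶠ[nhds x]
        fun y => ∑ a ∈ s, c a * wordD l (f a) y := by
      have : ∀ᶠ y in nhds x, ∀ a ∈ s, ContDiffAt ℝ (i :: l).length (f a) y :=
        (Filter.eventually_all_finset s).mpr fun a ha => (hf a ha).eventually (by simp)
      filter_upwards [this] with y hy
      exact ih fun a ha => (hy a ha).of_le (by simp)
    change partialD i (wordD l _) x = ∑ a ∈ s, c a * partialD i (wordD l (f a)) x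
    have hd : ∀ a ∈ s, DifferentiableAt ℝ (wordD l (f a)) x := fun a ha =>
      (contDiffAt_wordD (m := 1) l ((hf a ha).of_le (by simp [add_comm]))).differentiableAt
        (by simp)
    rw [(partialD_congr i hev).eq_of_nhds, partialD_sum i fun a ha => (hd a ha).const_mul _]
    refine Finset.sum_congr rfl fun a ha => ?_
    rw [partialD_mul i (differentiableAt_const _) (hd a ha)]
    simp [partialD]

end Calculus

/-! ### Coefficients and jets of operators -/

section Jets

variable {n : ℕ}

/-- The function `g(x,u)` is smooth near `(x₀, y)`. -/
def JointlySmooth (x₀ : EuclideanSpace ℝ (Fin n)) (y : ℝ)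
    (g : EuclideanSpace ℝ (Fin n) → ℝ → ℝ) : Prop :=
  ∀ᶠ q : EuclideanSpace ℝ (Fin n) × ℝ in nhds (x₀, y),
    ContDiffAt ℝ ∞ (fun s : EuclideanSpace ℝ (Fin n) × ℝ => g s.1 s.2) q

namespace JointlySmooth

variable {x₀ : EuclideanSpace ℝ (Fin n)} {y : ℝ} {g : EuclideanSpace ℝ (Fin n) → ℝ → ℝ}

theorem iteratedDeriv (hg : JointlySmooth x₀ y g) (j : ℕ) :
    JointlySmooth x₀ y (fun x => _root_.iteratedDeriv j (g x)) := by
  induction j with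
  | zero => simpa using hg
  | succ j ih =>
    filter_upwards [Filter.Eventually.eventually_nhds ih] with q hq
    have hq' : (fun s : EuclideanSpace ℝ (Fin n) × ℝ => _root_.iteratedDeriv (j + 1) (g s.1) s.2)
        =ᶠ[nhds q] fun s => fderiv ℝ (fun s : EuclideanSpace ℝ (Fin n) × ℝ =>
          _root_.iteratedDeriv j (g s.1) s.2) s (0, 1) := by
      filter_upwards [hq] with s hs
      rw [iteratedDeriv_succ]
      have h1 : HasDerivAt (fun u : ℝ => (s.1, u)) ((0 : EuclideanSpace ℝ (Fin n)), (1 : ℝ)) s.2 :=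
        (hasDerivAt_const _ _).prodMk (hasDerivAt_id _)
      exact ((hs.differentiableAt (by simp)).hasFDerivAt.comp_hasDerivAt s.2 h1).deriv
    refine ContDiffAt.congr_of_eventuallyEq ?_ hq'
    exact ((hq.self_of_nhds).fderiv_right (m := ∞) (by simp)).clm_apply contDiffAt_const

theorem left (hg : JointlySmooth x₀ y g) : ∀ᶠ x in nhds x₀, ContDiffAt ℝ ∞ (fun x => g x y) x := by
  filter_upwards [hg.curry_nhds] with x hx
  exact hx.self_of_nhds.comp x (contDiffAt_id.prodMk contDiffAt_const)

theorem right (hg : JointlySmooth x₀ y g) : ∀ᶠ x in nhds x₀, ContDiffAt ℝ ∞ (g x) y := by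
  filter_upwards [hg.curry_nhds] with x hx
  exact hx.self_of_nhds.comp y (contDiffAt_const.prodMk contDiffAt_id)

end JointlySmooth

variable {M : Type*} [TopologicalSpace M] [ChartedSpace (EuclideanSpace ℝ (Fin n)) M]

/-- In the local coordinates at `b`, the operator `A` is `∑ a_σ(x,u) ∂^σ` near `(b, y)`. -/
def HasCoeffs (k : ℕ) (b : M) (y : ℝ) (A : (M → ℝ) → M → ℝ → ℝ)
    (a : (Fin n → ℕ) → EuclideanSpace ℝ (Fin n) → ℝ → ℝ) : Prop :=
  ∀ᶠ q : M × ℝ in nhds (b, y), ∀ g : M → ℝ, ContMDiffAt (𝓡 n) 𝓘(ℝ, ℝ) ∞ g q.1 →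
    A g q.1 q.2 = ∑ σ ∈ multiIndices n k,
      a σ (extChartAt (𝓡 n) b q.1) q.2 *
        multiD σ (g ∘ (extChartAt (𝓡 n) b).symm) (extChartAt (𝓡 n) b q.1)

theorem chartMonomial_comp_symm (b : M) (x : EuclideanSpace ℝ (Fin n)) (σ : Fin n → ℕ)
    {x' : EuclideanSpace ℝ (Fin n)} (hx' : x' ∈ (extChartAt (𝓡 n) b).target) :
    chartMonomial b x σ ∘ (extChartAt (𝓡 n) b).symm =ᶠ[nhds x'] taylorMonomial x σ := by
  filter_upwards [(isOpen_extChartAt_target b).mem_nhds hx'] with z hz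
  simp only [Function.comp_apply, chartMonomial, taylorMonomial, (extChartAt (𝓡 n) b).right_inv hz]

section Smooth

variable [IsManifold (𝓡 n) ∞ M]

theorem contDiffAt_comp_symm {b : M} {g : M → ℝ} {z : M}
    (hz : z ∈ (extChartAt (𝓡 n) b).source) (hg : ContMDiffAt (𝓡 n) 𝓘(ℝ, ℝ) ∞ g z) :
    ContDiffAt ℝ ∞ (g ∘ (extChartAt (𝓡 n) b).symm) (extChartAt (𝓡 n) b z) := by
  rw [← contMDiffAt_iff_contDiffAt]
  have h1 : ContMDiffAt 𝓘(ℝ, EuclideanSpace ℝ (Fin n)) (𝓡 n) ∞ (extChartAt (𝓡 n) b).symm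
      (extChartAt (𝓡 n) b z) :=
    (contMDiffOn_extChartAt_symm b).contMDiffAt
      ((isOpen_extChartAt_target b).mem_nhds ((extChartAt (𝓡 n) b).map_source hz))
  refine ContMDiffAt.comp (I' := 𝓡 n) _ ?_ h1
  rwa [(extChartAt (𝓡 n) b).left_inv hz]

theorem contMDiffAt_comp_chart {b : M} {h : EuclideanSpace ℝ (Fin n) → ℝ} {z : M}
    (hz : z ∈ (extChartAt (𝓡 n) b).source) (hh : ContDiffAt ℝ ∞ h (extChartAt (𝓡 n) b z)) :
    ContMDiffAt (𝓡 n) 𝓘(ℝ, ℝ) ∞ (fun z => h (extChartAt (𝓡 n) b z)) z := by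
  have h1 : ContMDiffAt (𝓡 n) 𝓘(ℝ, EuclideanSpace ℝ (Fin n)) ∞ (extChartAt (𝓡 n) b) z :=
    contMDiffAt_extChartAt' (by rwa [extChartAt_source] at hz)
  exact ContMDiffAt.comp (I' := 𝓘(ℝ, EuclideanSpace ℝ (Fin n))) z
    (contMDiffAt_iff_contDiffAt.mpr hh) h1

/-- The values of an operator at the Taylor monomials recover its coefficients. -/
theorem HasCoeffs.coeffAt_eq {k : ℕ} {b : M} {y : ℝ} {A : (M → ℝ) → M → ℝ → ℝ}
    {a : (Fin n → ℕ) → EuclideanSpace ℝ (Fin n) → ℝ → ℝ} (hA : HasCoeffs k b y A a) :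
    ∀ᶠ q : EuclideanSpace ℝ (Fin n) × ℝ in nhds (extChartAt (𝓡 n) b b, y),
      ∀ σ ∈ multiIndices n k, coeffAt b A σ q.1 q.2 = a σ q.1 q.2 := by
  have hc : Filter.Tendsto (fun q : EuclideanSpace ℝ (Fin n) × ℝ =>
      ((extChartAt (𝓡 n) b).symm q.1, q.2)) (nhds (extChartAt (𝓡 n) b b, y)) (nhds (b, y)) := by
    have h1 : ContinuousAt (extChartAt (𝓡 n) b).symm (extChartAt (𝓡 n) b b) :=
      continuousAt_extChartAt_symm b
    rw [ContinuousAt, extChartAt_to_inv] at h1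
    rw [nhds_prod_eq, nhds_prod_eq]
    exact h1.prodMap Filter.tendsto_id
  have ht : ∀ᶠ q : EuclideanSpace ℝ (Fin n) × ℝ in nhds (extChartAt (𝓡 n) b b, y),
      q.1 ∈ (extChartAt (𝓡 n) b).target :=
    continuousAt_fst.eventually
      ((isOpen_extChartAt_target b).eventually_mem (mem_extChartAt_target b))
  filter_upwards [hc.eventually hA, ht] with q hq hqt σ hσ
  have hsrc := (extChartAt (𝓡 n) b).map_target hqt
  have hinv := (extChartAt (𝓡 n) b).right_inv hqt
  unfold coeffAt
  rw [hq (chartMonomial b q.1 σ) (contMDiffAt_comp_chart (h := taylorMonomial q.1 σ) hsrc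
    (contDiff_taylorMonomial _ _).contDiffAt)]
  simp only [hinv, multiD_congr _ (chartMonomial_comp_symm b q.1 σ hqt), multiD_taylorMonomial]
  simp [hσ]

/-- The coordinates `a_{σ,β,j}` are the derivatives of any coefficients that represent the operator
near `(b, y)`. -/
theorem HasCoeffs.jetOf_inl {k : ℕ} {b : M} {y : ℝ} {A : (M → ℝ) → M → ℝ → ℝ}
    {a : (Fin n → ℕ) → EuclideanSpace ℝ (Fin n) → ℝ → ℝ} (hA : HasCoeffs k b y A a) (f : M → ℝ)
    (σ : multiIndices n k) (β : Fin n → ℕ) (j : ℕ) :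
    jetOf k b y A f (Sum.inl (σ, β, j)) =
      multiD β (fun x => iteratedDeriv j (a σ x) y) (extChartAt (𝓡 n) b b) := by
  apply multiD_congr
  filter_upwards [hA.coeffAt_eq.curry_nhds] with x hx
  apply Filter.EventuallyEq.iteratedDeriv_eq
  filter_upwards [hx] with u hu
  exact hu σ σ.2

end Smooth

/-! ### The action of a local diffeomorphism on jets -/

/-- The expression of a map `φ` in the local coordinates at `b`. -/
def localRep (b : M) (φ : M → M) : EuclideanSpace ℝ (Fin n) → EuclideanSpace ℝ (Fin n) :=
  fun x => extChartAt (𝓡 n) b (φ ((extChartAt (𝓡 n) b).symm x))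

/-- The points of the coordinate domain at `b` whose image under `φ` lies in the chart at `b`. -/
def localDomain (b : M) (φ : PartialDiffeomorph (𝓡 n) (𝓡 n) M M ∞) :
    Set (EuclideanSpace ℝ (Fin n)) :=
  (extChartAt (𝓡 n) b).target ∩ (extChartAt (𝓡 n) b).symm ⁻¹'
    (φ.source ∩ φ ⁻¹' (extChartAt (𝓡 n) b).source)

section LocalRep

variable (b : M) (φ : PartialDiffeomorph (𝓡 n) (𝓡 n) M M ∞)

theorem isOpen_localDomain : IsOpen (localDomain b φ) :=
  (continuousOn_extChartAt_symm b).isOpen_inter_preimage (isOpen_extChartAt_target b)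
    (φ.contMDiffOn.continuousOn.isOpen_inter_preimage φ.open_source (isOpen_extChartAt_source b))

theorem mem_localDomain (hb : b ∈ φ.source) (hφ : φ b = b) :
    extChartAt (𝓡 n) b b ∈ localDomain b φ := by
  refine ⟨mem_extChartAt_target b, ?_⟩
  rw [Set.mem_preimage, extChartAt_to_inv]
  exact ⟨hb, by rw [Set.mem_preimage, hφ]; exact mem_extChartAt_source b⟩

theorem localRep_base (hφ : φ b = b) :
    localRep b φ (extChartAt (𝓡 n) b b) = extChartAt (𝓡 n) b b := by
  unfold localRep
  rw [extChartAt_to_inv, hφ]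

theorem contDiffOn_localRep [IsManifold (𝓡 n) ∞ M] :
    ContDiffOn ℝ ∞ (localRep b φ) (localDomain b φ) := by
  rw [← contMDiffOn_iff_contDiffOn]
  have h1 : ContMDiffOn 𝓘(ℝ, EuclideanSpace ℝ (Fin n)) (𝓡 n) ∞ (extChartAt (𝓡 n) b).symm
      (localDomain b φ) := (contMDiffOn_extChartAt_symm b).mono fun x hx => hx.1
  have h2 := φ.contMDiffOn.comp h1 fun x hx => hx.2.1
  have h3 : ContMDiffOn (𝓡 n) 𝓘(ℝ, EuclideanSpace ℝ (Fin n)) ∞ (extChartAt (𝓡 n) b)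
      (chartAt (EuclideanSpace ℝ (Fin n)) b).source := contMDiffOn_extChartAt
  refine h3.comp h2 fun x hx => ?_
  have := hx.2.2
  rwa [Set.mem_preimage, extChartAt_source] at this

theorem localRep_mem {x : EuclideanSpace ℝ (Fin n)} (hx : x ∈ localDomain b φ) :
    localRep b φ x ∈ localDomain b φ.symm := by
  obtain ⟨hx1, hx2, hx3⟩ := hx
  rw [Set.mem_preimage] at hx3
  refine ⟨(extChartAt (𝓡 n) b).map_source hx3, ?_⟩
  have h : (extChartAt (𝓡 n) b).symm (localRep b φ x) = φ ((extChartAt (𝓡 n) b).symm x) :=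
    (extChartAt (𝓡 n) b).left_inv hx3
  rw [Set.mem_preimage, h]
  refine ⟨φ.map_source hx2, ?_⟩
  rw [Set.mem_preimage]
  change φ.toPartialEquiv.symm (φ.toPartialEquiv _) ∈ _
  rw [φ.left_inv hx2]
  exact (extChartAt (𝓡 n) b).map_target hx1

theorem localRep_symm_localRep {x : EuclideanSpace ℝ (Fin n)} (hx : x ∈ localDomain b φ) :
    localRep b φ.symm (localRep b φ x) = x := by
  obtain ⟨hx1, hx2, hx3⟩ := hx
  unfold localRep
  rw [(extChartAt (𝓡 n) b).left_inv hx3]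
  change extChartAt (𝓡 n) b (φ.toPartialEquiv.symm (φ.toPartialEquiv _)) = x
  rw [φ.left_inv hx2, (extChartAt (𝓡 n) b).right_inv hx1]

variable {b φ}

theorem symm_fixes (hb : b ∈ φ.source) (hφ : φ b = b) : b ∈ φ.symm.source ∧ φ.symm b = b := by
  have h : b ∈ φ.target := by
    have := φ.map_source hb
    rwa [hφ] at this
  refine ⟨h, ?_⟩
  have := φ.left_inv hb
  rwa [hφ] at this

theorem continuousAt_of_mem {z : M} (hz : z ∈ φ.source) : ContinuousAt φ z :=
  φ.contMDiffOn.continuousOn.continuousAt (φ.open_source.mem_nhds hz)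

theorem tendsto_of_fixes (hb : b ∈ φ.source) (hφ : φ b = b) :
    Filter.Tendsto φ (nhds b) (nhds b) := by
  have := continuousAt_of_mem hb
  rwa [ContinuousAt, hφ] at this

end LocalRep

variable [IsManifold (𝓡 n) ∞ M]

/-- The coefficients of the pushed forward operator: they are combinations of the coefficients of
the operator at the preimage point, with smooth coefficients that depend only on `φ`. -/
theorem exists_pushOperator_coeffs (k : ℕ) {b : M} {φ : PartialDiffeomorph (𝓡 n) (𝓡 n) M M ∞}
    (hb : b ∈ φ.source) (hφ : φ b = b) :
    ∃ c : (Fin n → ℕ) → (Fin n → ℕ) → EuclideanSpace ℝ (Fin n) → ℝ,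
      (∀ τ γ, ContDiffOn ℝ ∞ (c τ γ) (localDomain b φ.symm)) ∧
      ∀ (y : ℝ) (A : (M → ℝ) → M → ℝ → ℝ) (a : (Fin n → ℕ) → EuclideanSpace ℝ (Fin n) → ℝ → ℝ),
        HasCoeffs k b y A a → HasCoeffs k b y (pushOperator φ A)
          (fun γ x u => ∑ τ ∈ multiIndices n k, c τ γ x * a τ (localRep b φ.symm x) u) := by
  have hpull : ∀ τ ∈ multiIndices n k, IsPullbackOperator (localDomain b φ) (localRep b φ) k
      (fun h => multiD τ (fun y => 1 * h (localRep b φ y))) := fun τ hτ =>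
    (isPullbackOperator_multiD (isOpen_localDomain b φ) (contDiffOn_localRep b φ)
      contDiffOn_const rfl).mono (mem_multiIndices.mp hτ)
  choose! Λ hΛ hform using hpull
  obtain ⟨hb', hφ'⟩ := symm_fixes hb hφ
  have hmaps : Set.MapsTo (localRep b φ.symm) (localDomain b φ.symm) (localDomain b φ) :=
    fun x hx => localRep_mem b φ.symm hx
  classical
  refine ⟨fun τ γ x => if τ ∈ multiIndices n k then Λ τ γ (localRep b φ.symm x) else 0,
    fun τ γ => ?_, fun y A a hA => ?_⟩
  · by_cases hτ : τ ∈ multiIndices n k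
    · simp only [hτ, if_true]
      exact (hΛ τ hτ γ).comp (contDiffOn_localRep b φ.symm) hmaps
    · simp only [hτ, if_false]
      exact contDiffOn_const
  · have htend : Filter.Tendsto (fun q : M × ℝ => (φ.symm q.1, q.2)) (nhds (b, y))
        (nhds (b, y)) := by
      rw [nhds_prod_eq]
      exact (tendsto_of_fixes hb' hφ').prodMap Filter.tendsto_id
    have hdom : ∀ᶠ z in nhds b, z ∈ (extChartAt (𝓡 n) b).source ∧
        extChartAt (𝓡 n) b z ∈ localDomain b φ.symm :=
      ((isOpen_extChartAt_source b).eventually_mem (mem_extChartAt_source b)).and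
        ((continuousAt_extChartAt b).eventually
          ((isOpen_localDomain b φ.symm).eventually_mem (mem_localDomain b φ.symm hb' hφ')))
    filter_upwards [htend.eventually hA, continuousAt_fst.eventually hdom] with q hq hqd g hg
    obtain ⟨hsrc, hmem⟩ := hqd
    set e := extChartAt (𝓡 n) b with he
    have hez : e.symm (e q.1) = q.1 := e.left_inv hsrc
    have hz : q.1 ∈ φ.target := by
      have := hmem.2.1
      rwa [hez] at this
    have hz' : φ.symm q.1 ∈ φ.source := φ.map_target hz
    have hzz : φ (φ.symm q.1) = q.1 := φ.right_inv hz
    have hrep : e (φ.symm q.1) = localRep b φ.symm (e q.1) := by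
      unfold localRep
      rw [← he, hez]
    have hgφ : ContMDiffAt (𝓡 n) 𝓘(ℝ, ℝ) ∞ (fun z => g (φ z)) (φ.symm q.1) := by
      refine ContMDiffAt.comp (I' := 𝓡 n) _ ?_
        (φ.contMDiffOn.contMDiffAt (φ.open_source.mem_nhds hz'))
      rwa [hzz]
    change A (fun z => g (φ z)) (φ.symm q.1) q.2 = _
    rw [hq _ hgφ, hrep]
    have hx' := hmaps hmem
    have hback : localRep b φ (localRep b φ.symm (e q.1)) = e q.1 :=
      localRep_symm_localRep b φ.symm hmem
    have hderiv : ∀ τ ∈ multiIndices n k,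
        multiD τ ((fun z => g (φ z)) ∘ e.symm) (localRep b φ.symm (e q.1)) =
          ∑ γ ∈ multiIndices n k, Λ τ γ (localRep b φ.symm (e q.1)) *
            multiD γ (g ∘ e.symm) (e q.1) := by
      intro τ hτ
      have hev : ((fun z => g (φ z)) ∘ e.symm) =ᶠ[nhds (localRep b φ.symm (e q.1))]
          fun x => 1 * (g ∘ e.symm) (localRep b φ x) := by
        filter_upwards [(isOpen_localDomain b φ).mem_nhds hx'] with x hx
        simp only [one_mul, Function.comp_apply, localRep]
        rw [← he, e.left_inv hx.2.2]
      rw [multiD_congr τ hev]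
      have := hform τ hτ _ hx' (g ∘ e.symm) (by
        rw [hback]
        exact (contDiffAt_comp_symm hsrc hg).of_le (by exact_mod_cast le_top))
      rwa [hback] at this
    rw [Finset.sum_congr rfl fun τ hτ => by rw [hderiv τ hτ]]
    simp only [Finset.mul_sum, Finset.sum_mul]
    rw [Finset.sum_comm]
    refine Finset.sum_congr rfl fun γ _ => Finset.sum_congr rfl fun τ hτ => ?_
    rw [if_pos hτ]
    ring

theorem jointlySmooth_push_coeffs {k : ℕ} {b : M} {φ : PartialDiffeomorph (𝓡 n) (𝓡 n) M M ∞}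
    (hb : b ∈ φ.source) (hφ : φ b = b) {y : ℝ}
    {a : (Fin n → ℕ) → EuclideanSpace ℝ (Fin n) → ℝ → ℝ}
    (ha : ∀ σ ∈ multiIndices n k, JointlySmooth (extChartAt (𝓡 n) b b) y (a σ))
    {c : (Fin n → ℕ) → EuclideanSpace ℝ (Fin n) → ℝ}
    (hc : ∀ τ, ContDiffOn ℝ ∞ (c τ) (localDomain b φ.symm)) :
    JointlySmooth (extChartAt (𝓡 n) b b) y
      (fun x u => ∑ τ ∈ multiIndices n k, c τ x * a τ (localRep b φ.symm x) u) := by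
  obtain ⟨hb', hφ'⟩ := symm_fixes hb hφ
  have hU := isOpen_localDomain b φ.symm
  have hmem := mem_localDomain b φ.symm hb' hφ'
  have hψ := contDiffOn_localRep b φ.symm
  have htend : Filter.Tendsto (fun q : EuclideanSpace ℝ (Fin n) × ℝ =>
      (localRep b φ.symm q.1, q.2)) (nhds (extChartAt (𝓡 n) b b, y))
      (nhds (extChartAt (𝓡 n) b b, y)) := by
    have h1 : ContinuousAt (localRep b φ.symm) (extChartAt (𝓡 n) b b) :=
      hψ.continuousOn.continuousAt (hU.mem_nhds hmem)
    rw [ContinuousAt, localRep_base b φ.symm hφ'] at h1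
    rw [nhds_prod_eq]
    exact h1.prodMap Filter.tendsto_id
  have h2 : ∀ᶠ q in nhds (extChartAt (𝓡 n) b b, y), ∀ τ ∈ multiIndices n k,
      ContDiffAt ℝ ∞ (fun s : EuclideanSpace ℝ (Fin n) × ℝ => a τ s.1 s.2)
        (localRep b φ.symm q.1, q.2) :=
    (Filter.eventually_all_finset _).mpr fun τ hτ => htend.eventually (ha τ hτ)
  filter_upwards [h2, continuousAt_fst.eventually (hU.eventually_mem hmem)]
    with q hq hqU
  refine ContDiffAt.sum fun τ hτ => ?_
  have hψq : ContDiffAt ℝ ∞ (fun s : EuclideanSpace ℝ (Fin n) × ℝ => localRep b φ.symm s.1) q :=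
    (hψ.contDiffAt (hU.mem_nhds hqU)).comp q contDiffAt_fst
  refine ContDiffAt.mul (((hc τ).contDiffAt (hU.mem_nhds hqU)).comp q contDiffAt_fst) ?_
  exact (hq τ hτ).comp q (hψq.prodMk contDiffAt_snd)

/-- The coordinates `a_{σ,β,j}` of the pushed forward operator are linear combinations of the
coordinates `a_{τ,δ,j}` of the operator, with real coefficients that depend only on `φ`, and not on
`j`, because `φ` fixes `u`. -/
theorem exists_jetOf_push_inl (k : ℕ) {b : M} {φ : PartialDiffeomorph (𝓡 n) (𝓡 n) M M ∞}
    (hb : b ∈ φ.source) (hφ : φ b = b) :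
    ∃ R : multiIndices n k → (Fin n → ℕ) → multiIndices n k → (Fin n → ℕ) → ℝ,
      ∀ (y : ℝ) (A : (M → ℝ) → M → ℝ → ℝ) (a : (Fin n → ℕ) → EuclideanSpace ℝ (Fin n) → ℝ → ℝ),
        (∀ σ ∈ multiIndices n k, JointlySmooth (extChartAt (𝓡 n) b b) y (a σ)) →
        HasCoeffs k b y A a → ∀ (f g : M → ℝ) (σ : multiIndices n k) (β : Fin n → ℕ) (j : ℕ),
          jetOf k b y (pushOperator φ A) g (Sum.inl (σ, β, j)) =
            ∑ τ, ∑ δ ∈ multiIndices n (∑ i, β i),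
              R σ β τ δ * jetOf k b y A f (Sum.inl (τ, δ, j)) := by
  obtain ⟨c, hc, hcoeff⟩ := exists_pushOperator_coeffs k hb hφ
  obtain ⟨hb', hφ'⟩ := symm_fixes hb hφ
  have hU := isOpen_localDomain b φ.symm
  have hmem := mem_localDomain b φ.symm hb' hφ'
  have hψ := contDiffOn_localRep b φ.symm
  have hbase := localRep_base b φ.symm hφ'
  choose Λ _ hform using fun (τ γ β : Fin n → ℕ) =>
    isPullbackOperator_multiD hU hψ (hc τ γ) (m := ∑ i, β i) (β := β) rfl
  refine ⟨fun σ β τ δ => Λ τ σ β δ (extChartAt (𝓡 n) b b), fun y A a ha hA f g σ β j => ?_⟩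
  rw [(hcoeff y A a hA).jetOf_inl]
  simp only [hA.jetOf_inl]
  have hψc : Filter.Tendsto (localRep b φ.symm) (nhds (extChartAt (𝓡 n) b b))
      (nhds (extChartAt (𝓡 n) b b)) := by
    have h1 : ContinuousAt (localRep b φ.symm) (extChartAt (𝓡 n) b b) :=
      hψ.continuousOn.continuousAt (hU.mem_nhds hmem)
    rwa [ContinuousAt, hbase] at h1
  have hev : (fun x => iteratedDeriv j (fun u => ∑ τ ∈ multiIndices n k,
      c τ σ x * a τ (localRep b φ.symm x) u) y) =ᶠ[nhds (extChartAt (𝓡 n) b b)]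
      fun x => ∑ τ ∈ multiIndices n k,
        1 * (c τ σ x * (fun x => iteratedDeriv j (a τ x) y) (localRep b φ.symm x)) := by
    have h2 : ∀ᶠ x in nhds (extChartAt (𝓡 n) b b), ∀ τ ∈ multiIndices n k,
        ContDiffAt ℝ ∞ (a τ (localRep b φ.symm x)) y :=
      (Filter.eventually_all_finset _).mpr fun τ hτ => hψc.eventually (ha τ hτ).right
    filter_upwards [h2] with x hx
    rw [iteratedDeriv_fun_sum fun τ hτ =>
      contDiffAt_const.mul ((hx τ hτ).of_le (by exact_mod_cast le_top))]
    refine Finset.sum_congr rfl fun τ _ => ?_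
    rw [iteratedDeriv_const_mul_field, one_mul]
  have hsm : ∀ τ ∈ multiIndices n k,
      ContDiffAt ℝ ∞ (fun x => iteratedDeriv j (a τ x) y) (extChartAt (𝓡 n) b b) :=
    fun τ hτ => ((ha τ hτ).iteratedDeriv j).left.self_of_nhds
  rw [multiD_congr β hev, multiD_sum_smul β]
  · rw [← Finset.sum_coe_sort (multiIndices n k)]
    refine Finset.sum_congr rfl fun τ _ => ?_
    have h := hform τ σ β _ hmem (fun x => iteratedDeriv j (a τ x) y) (by
      rw [hbase]
      exact (hsm τ τ.2).of_le (by exact_mod_cast le_top))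
    rw [hbase] at h
    rw [one_mul]
    exact h
  · intro τ hτ
    refine ContDiffAt.mul (((hc τ σ).contDiffAt (hU.mem_nhds hmem)).of_le
      (by exact_mod_cast le_top)) ?_
    refine ContDiffAt.comp (g := fun x => iteratedDeriv j (a τ x) y) _ ?_
      ((hψ.contDiffAt (hU.mem_nhds hmem)).of_le (by exact_mod_cast le_top))
    rw [hbase]
    exact (hsm τ hτ).of_le (by exact_mod_cast le_top)

theorem multiD_one {γ : Fin n → ℕ} (hγ : γ ≠ 0) (x : EuclideanSpace ℝ (Fin n)) :
    multiD γ (fun _ => 1) x = 0 := by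
  have h := multiD_taylorMonomial x γ 0
  rw [if_neg (Ne.symm hγ)] at h
  rw [← h]
  congr 1
  ext z
  simp [taylorMonomial]

/-- The coordinates `p_γ` of the pushed forward function are linear combinations of the coordinates
`p_δ` of the function. The value of the function itself does not enter, because constants are mapped
to constants. -/
theorem exists_jetOf_push_inr (k : ℕ) {b : M} {φ : PartialDiffeomorph (𝓡 n) (𝓡 n) M M ∞}
    (hb : b ∈ φ.source) (hφ : φ b = b) :
    ∃ S : {γ : Fin n → ℕ // γ ≠ 0} → {γ : Fin n → ℕ // γ ≠ 0} → ℝ,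
      ∀ (y : ℝ) (A B : (M → ℝ) → M → ℝ → ℝ) (f : M → ℝ), SmoothNear (n := n) b f →
        ∀ γ, jetOf k b y B (pushFunction φ f) (Sum.inr γ) =
          ∑ δ ∈ (multiIndices n (∑ i, γ.1 i)).subtype (· ≠ 0),
            S γ δ * jetOf k b y A f (Sum.inr δ) := by
  obtain ⟨hb', hφ'⟩ := symm_fixes hb hφ
  have hU := isOpen_localDomain b φ.symm
  have hmem := mem_localDomain b φ.symm hb' hφ'
  have hψ := contDiffOn_localRep b φ.symm
  have hbase := localRep_base b φ.symm hφ'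
  choose Λ _ hform using fun (γ : Fin n → ℕ) =>
    isPullbackOperator_multiD hU hψ (c := fun _ => 1) contDiffOn_const (m := ∑ i, γ i) (β := γ) rfl
  -- the coefficient of the undifferentiated function is read off at the constant function `1`
  have h0 : ∀ γ : Fin n → ℕ, γ ≠ 0 → Λ γ 0 (extChartAt (𝓡 n) b b) = 0 := by
    intro γ hγ
    have h := hform γ _ hmem (fun _ => 1) contDiffAt_const
    rw [hbase] at h
    simp only [mul_one] at h
    rw [multiD_one hγ, Finset.sum_eq_single_of_mem 0 (mem_multiIndices.mpr (by simp))] at h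
    · simpa using h.symm
    · intro δ _ hδ
      rw [multiD_one hδ, mul_zero]
  refine ⟨fun γ δ => Λ γ δ (extChartAt (𝓡 n) b b), fun y A B f hf γ => ?_⟩
  change multiD γ.1 (pushFunction φ f ∘ (extChartAt (𝓡 n) b).symm) _ =
    ∑ δ ∈ (multiIndices n (∑ i, γ.1 i)).subtype (· ≠ 0),
      Λ γ.1 δ.1 (extChartAt (𝓡 n) b b) * multiD δ.1 (f ∘ (extChartAt (𝓡 n) b).symm) _
  have hev : pushFunction φ f ∘ (extChartAt (𝓡 n) b).symm =ᶠ[nhds (extChartAt (𝓡 n) b b)]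
      fun x => 1 * (f ∘ (extChartAt (𝓡 n) b).symm) (localRep b φ.symm x) := by
    filter_upwards [hU.mem_nhds hmem] with x hx
    simp only [one_mul, Function.comp_apply, localRep, pushFunction]
    rw [(extChartAt (𝓡 n) b).left_inv hx.2.2]
  have hsm : ContDiffAt ℝ ∞ (f ∘ (extChartAt (𝓡 n) b).symm) (extChartAt (𝓡 n) b b) :=
    contDiffAt_comp_symm (mem_extChartAt_source b) hf.self_of_nhds
  have h := hform γ.1 _ hmem (f ∘ (extChartAt (𝓡 n) b).symm) (by
    rw [hbase]; exact hsm.of_le (by exact_mod_cast le_top))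
  rw [hbase] at h
  refine (multiD_congr γ.1 hev).trans (h.trans ?_)
  rw [Finset.sum_subtype_eq_sum_filter
    (f := fun δ => Λ γ.1 δ (extChartAt (𝓡 n) b b) *
      multiD δ (f ∘ (extChartAt (𝓡 n) b).symm) (extChartAt (𝓡 n) b b))]
  refine (Finset.sum_filter_of_ne fun δ _ hδ => ?_).symm
  rintro rfl
  rw [h0 γ.1 γ.2, zero_mul] at hδ
  exact hδ rfl

end Jets

/-! ### Functions of type `F` along a branch -/

section Branch

variable {F : Type*} [Field F] [Algebra (RatFunc ℝ) F] {y : ℝ} {ρ : F →+* LaurentSeries ℂ}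

theorem BelongsAt.sum_mul (hρ : IsBranchAt y ρ) {ι : Type*} {s : Finset ι} (c : ι → ℝ)
    {g : ι → ℝ → ℝ} (hg : ∀ i ∈ s, BelongsAt y ρ (g i)) :
    BelongsAt y ρ (fun u => ∑ i ∈ s, c i * g i u) := by
  choose! han w hw using hg
  refine ⟨Finset.analyticAt_fun_sum _ fun i hi => analyticAt_const.mul (han i hi),
    ∑ i ∈ s, algebraMap (RatFunc ℝ) F (RatFunc.C (c i)) * w i, ?_⟩
  have hps : (PowerSeries.mk fun m =>
      ((iteratedDeriv m (fun u => ∑ i ∈ s, c i * g i u) y / (m.factorial : ℝ) : ℝ) : ℂ)) =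
      ∑ i ∈ s, PowerSeries.C (c i : ℂ) *
        PowerSeries.mk fun m => ((iteratedDeriv m (g i) y / (m.factorial : ℝ) : ℝ) : ℂ) := by
    ext m
    rw [map_sum, PowerSeries.coeff_mk, iteratedDeriv_fun_sum fun i hi =>
      contDiffAt_const.mul (han i hi).contDiffAt, Finset.sum_div]
    push_cast
    refine Finset.sum_congr rfl fun i hi => ?_
    rw [PowerSeries.coeff_C_mul, PowerSeries.coeff_mk, iteratedDeriv_const_mul_field]
    push_cast
    ring
  rw [hps, map_sum, map_sum]
  refine Finset.sum_congr rfl fun i hi => ?_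
  rw [map_mul, map_mul, hρ.1, hw i hi, HahnSeries.ofPowerSeries_C]

theorem iteratedDeriv_pow_div_factorial (y : ℝ) (m j : ℕ) :
    iteratedDeriv m (fun u : ℝ => (u - y) ^ j / (j.factorial : ℝ)) y = if m = j then 1 else 0 := by
  induction m generalizing j with
  | zero =>
    rcases j with _ | j
    · simp
    · simp
  | succ m ih =>
    rw [iteratedDeriv_succ']
    rcases j with _ | j
    · simp
    · rw [show deriv (fun u : ℝ => (u - y) ^ (j + 1) / ((j + 1).factorial : ℝ)) =
          fun u => (u - y) ^ j / (j.factorial : ℝ) from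
        funext fun u => (hasDerivAt_pow_div_factorial y j u).deriv, ih]
      simp

theorem belongsAt_pow_div_factorial (hρ : IsBranchAt y ρ) (j : ℕ) :
    BelongsAt y ρ (fun u => (u - y) ^ j / (j.factorial : ℝ)) := by
  refine ⟨by fun_prop, algebraMap (RatFunc ℝ) F (RatFunc.C ((j.factorial : ℝ)⁻¹)) *
    (algebraMap (RatFunc ℝ) F RatFunc.X - algebraMap (RatFunc ℝ) F (RatFunc.C y)) ^ j, ?_⟩
  have hps : (PowerSeries.mk fun m =>
      ((iteratedDeriv m (fun u : ℝ => (u - y) ^ j / (j.factorial : ℝ)) y / (m.factorial : ℝ) : ℝ)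
        : ℂ)) = PowerSeries.C (((j.factorial : ℝ)⁻¹ : ℝ) : ℂ) * PowerSeries.X ^ j := by
    ext m
    rw [PowerSeries.coeff_mk, iteratedDeriv_pow_div_factorial, PowerSeries.coeff_C_mul,
      PowerSeries.coeff_X_pow]
    split_ifs with h
    · subst h; simp
    · simp
  rw [hps, map_mul, map_mul, map_pow, map_pow, map_sub, hρ.1, hρ.1, hρ.2, add_sub_cancel_left,
    HahnSeries.ofPowerSeries_C, HahnSeries.ofPowerSeries_X]

end Branch

/-! ### Related pairs -/

section Pairs

variable {n k : ℕ} {M : Type*} [TopologicalSpace M] [ChartedSpace (EuclideanSpace ℝ (Fin n)) M]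
  {F : Type*} [Field F] [Algebra (RatFunc ℝ) F] {b : M} {y : ℝ} {ρ : F →+* LaurentSeries ℂ}

/-- `(A, f)` is a related pair near `(b, y)`, of type `F` along the branch `ρ`. -/
structure IsRelatedPairAt (k : ℕ) (b : M) (y : ℝ) (ρ : F →+* LaurentSeries ℂ)
    (A : (M → ℝ) → M → ℝ → ℝ) (f : M → ℝ) : Prop where
  isOperatorAt : IsOperatorAt (n := n) k b y ρ A
  smoothNear : SmoothNear (n := n) b f
  value : f b = y

variable [IsManifold (𝓡 n) ∞ M]

/-- The images of related pairs are related pairs, of type `F` along the same branch: in the formula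
for the new coefficients only real multiples of functions of `u` occur when `x` is fixed. -/
theorem IsRelatedPairAt.push (hρ : IsBranchAt y ρ) {A : (M → ℝ) → M → ℝ → ℝ} {f : M → ℝ}
    (h : IsRelatedPairAt (n := n) k b y ρ A f) {φ : PartialDiffeomorph (𝓡 n) (𝓡 n) M M ∞}
    (hb : b ∈ φ.source) (hφ : φ b = b) :
    IsRelatedPairAt (n := n) k b y ρ (pushOperator φ A) (pushFunction φ f) := by
  obtain ⟨hb', hφ'⟩ := symm_fixes hb hφ
  refine ⟨?_, ?_, ?_⟩
  · obtain ⟨a, ha, hA⟩ := h.isOperatorAt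
    obtain ⟨c, hc, hcoeff⟩ := exists_pushOperator_coeffs k hb hφ
    refine ⟨fun γ x u => ∑ τ ∈ multiIndices n k, c τ γ x * a τ (localRep b φ.symm x) u,
      fun γ _ => ⟨?_, ?_⟩, hcoeff y A a hA⟩
    · exact jointlySmooth_push_coeffs hb hφ (fun σ hσ => (ha σ hσ).1) fun τ => hc τ γ
    · have hψc : Filter.Tendsto (localRep b φ.symm) (nhds (extChartAt (𝓡 n) b b))
          (nhds (extChartAt (𝓡 n) b b)) := by
        have h1 : ContinuousAt (localRep b φ.symm) (extChartAt (𝓡 n) b b) :=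
          (contDiffOn_localRep b φ.symm).continuousOn.continuousAt
            ((isOpen_localDomain b φ.symm).mem_nhds (mem_localDomain b φ.symm hb' hφ'))
        rwa [ContinuousAt, localRep_base b φ.symm hφ'] at h1
      have h2 : ∀ᶠ x in nhds (extChartAt (𝓡 n) b b), ∀ τ ∈ multiIndices n k,
          BelongsAt y ρ (a τ (localRep b φ.symm x)) :=
        (Filter.eventually_all_finset _).mpr fun τ hτ => hψc.eventually (ha τ hτ).2
      filter_upwards [h2] with x hx
      exact BelongsAt.sum_mul hρ (fun τ => c τ γ x) hx
  · have h1 := (tendsto_of_fixes hb' hφ').eventually h.smoothNear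
    filter_upwards [h1, φ.symm.open_source.eventually_mem hb'] with z hz hzs
    exact ContMDiffAt.comp (I' := 𝓡 n) z hz
      (φ.symm.contMDiffOn.contMDiffAt (φ.symm.open_source.mem_nhds hzs))
  · change f (φ.symm b) = y
    rw [hφ', h.value]

/-- Jets depend on germs only, so pushing forward by `φ⁻¹` and then by `φ` does not change them. -/
theorem jetOf_push_push_symm {A : (M → ℝ) → M → ℝ → ℝ} {f : M → ℝ}
    (h : IsRelatedPairAt (n := n) k b y ρ A f) {φ : PartialDiffeomorph (𝓡 n) (𝓡 n) M M ∞}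
    (hb : b ∈ φ.source) (hφ : φ b = b) :
    jetOf (n := n) k b y (pushOperator φ (pushOperator φ.symm A))
      (pushFunction φ (pushFunction φ.symm f)) = jetOf k b y A f := by
  obtain ⟨hb', hφ'⟩ := symm_fixes hb hφ
  have htgt : ∀ᶠ z in nhds b, z ∈ φ.target := φ.open_target.eventually_mem hb'
  have hinv : ∀ z ∈ φ.target, φ (φ.symm z) = z := fun z hz => φ.right_inv hz
  funext v
  rcases v with ⟨σ, β, j⟩ | γ
  · obtain ⟨a, ha, hA⟩ := h.isOperatorAt
    have hA' : HasCoeffs k b y (pushOperator φ (pushOperator φ.symm A)) a := by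
      filter_upwards [hA, continuousAt_fst.eventually htgt,
        continuousAt_fst.eventually ((isOpen_extChartAt_source b).eventually_mem
          (mem_extChartAt_source (I := 𝓡 n) b))] with q hq hqt hqs g hg
      have hev : (fun z => g (φ (φ.symm z))) =ᶠ[nhds q.1] g := by
        filter_upwards [φ.open_target.mem_nhds hqt] with z hz
        rw [hinv z hz]
      change A (fun z => g (φ (φ.symm z))) (φ (φ.symm q.1)) q.2 = _
      rw [hinv _ hqt, hq _ (hg.congr_of_eventuallyEq hev)]
      refine Finset.sum_congr rfl fun σ _ => ?_
      congr 1
      apply multiD_congr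
      have hc : Filter.Tendsto (extChartAt (𝓡 n) b).symm (nhds (extChartAt (𝓡 n) b q.1))
          (nhds q.1) := by
        have := continuousAt_extChartAt_symm' (I := 𝓡 n) hqs
        rwa [ContinuousAt, (extChartAt (𝓡 n) b).left_inv hqs] at this
      exact hc.eventually hev
    have hA₀ : HasCoeffs k b y A a := hA
    rw [hA'.jetOf_inl, hA₀.jetOf_inl]
  · apply multiD_congr
    have hc : Filter.Tendsto (extChartAt (𝓡 n) b).symm (nhds (extChartAt (𝓡 n) b b))
        (nhds b) := by
      have := continuousAt_extChartAt_symm (I := 𝓡 n) b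
      rwa [ContinuousAt, extChartAt_to_inv] at this
    filter_upwards [hc.eventually htgt] with x hx
    change f (φ (φ.symm _)) = f _
    rw [hinv _ hx]

/-- Every finitely supported family of real numbers is the family of jet coordinates of a related
pair, with polynomial coefficients and a polynomial function in the coordinates at `b`. -/
theorem exists_isRelatedPairAt_jetOf_eq (b : M) (hρ : IsBranchAt y ρ) (θ : JetVar n k →₀ ℝ) :
    ∃ A f, IsRelatedPairAt (n := n) k b y ρ A f ∧ jetOf k b y A f = θ := by
  classical
  set x₀ := extChartAt (𝓡 n) b b with hx₀
  set e := extChartAt (𝓡 n) b with he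
  -- finite sets of indices outside of which all coordinates in `θ` vanish
  let T : Finset ((Fin n → ℕ) × ℕ) := θ.support.image fun v => match v with
    | Sum.inl (_, p) => p
    | Sum.inr _ => (0, 0)
  let T' : Finset (Fin n → ℕ) := insert 0 (θ.support.image fun v => match v with
    | Sum.inl _ => 0
    | Sum.inr γ => γ.1)
  have hT : ∀ σ p, p ∉ T → θ (Sum.inl (σ, p)) = 0 := by
    intro σ p hp
    by_contra h
    exact hp (Finset.mem_image.mpr ⟨_, Finsupp.mem_support_iff.mpr h, rfl⟩)
  have hT' : ∀ γ, γ.1 ∉ T' → θ (Sum.inr γ) = 0 := by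
    intro γ hp
    by_contra h
    exact hp (Finset.mem_insert_of_mem
      (Finset.mem_image.mpr ⟨_, Finsupp.mem_support_iff.mpr h, rfl⟩))
  let cf : (Fin n → ℕ) → (Fin n → ℕ) × ℕ → ℝ := fun σ p =>
    if hσ : σ ∈ multiIndices n k then θ (Sum.inl (⟨σ, hσ⟩, p)) else 0
  let a : (Fin n → ℕ) → EuclideanSpace ℝ (Fin n) → ℝ → ℝ := fun σ x u =>
    ∑ p ∈ T, (cf σ p * taylorMonomial x₀ p.1 x) * ((u - y) ^ p.2 / (p.2.factorial : ℝ))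
  let A : (M → ℝ) → M → ℝ → ℝ := fun g z u =>
    ∑ σ ∈ multiIndices n k, a σ (e z) u * multiD σ (g ∘ e.symm) (e z)
  -- the constant term of the function has to be `y`
  let cg : (Fin n → ℕ) → ℝ := fun γ => if hγ : γ ≠ 0 then θ (Sum.inr ⟨γ, hγ⟩) else y
  let h : EuclideanSpace ℝ (Fin n) → ℝ := fun x => ∑ γ ∈ T', cg γ * taylorMonomial x₀ γ x
  have hh : ContDiff ℝ ∞ h :=
    ContDiff.sum fun γ _ => contDiff_const.mul (contDiff_taylorMonomial x₀ γ)
  have hA : HasCoeffs k b y A a := Filter.Eventually.of_forall fun q g _ => rfl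
  refine ⟨A, fun z => h (e z), ⟨⟨a, fun σ _ => ⟨?_, ?_⟩, hA⟩, ?_, ?_⟩, ?_⟩
  · refine Filter.Eventually.of_forall fun q => ContDiff.contDiffAt (ContDiff.sum fun p _ => ?_)
    refine ContDiff.mul (contDiff_const.mul ((contDiff_taylorMonomial x₀ p.1).comp contDiff_fst)) ?_
    fun_prop
  · exact Filter.Eventually.of_forall fun x =>
      BelongsAt.sum_mul hρ _ fun p _ => belongsAt_pow_div_factorial hρ p.2
  · filter_upwards [(isOpen_extChartAt_source (I := 𝓡 n) b).eventually_mem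
      (mem_extChartAt_source b)] with z hz
    exact contMDiffAt_comp_chart hz hh.contDiffAt
  · have h1 := fun γ => multiD_taylorMonomial x₀ 0 γ
    simp only [multiD_zero] at h1
    change ∑ γ ∈ T', cg γ * taylorMonomial x₀ γ x₀ = y
    simp only [h1]
    simp [T', cg]
  · funext v
    rcases v with ⟨σ, β, j⟩ | γ
    · rw [hA.jetOf_inl]
      have hj : ∀ x, iteratedDeriv j (a σ x) y =
          ∑ p ∈ T, (cf σ p * if j = p.2 then 1 else 0) * taylorMonomial x₀ p.1 x := by
        intro x
        change iteratedDeriv j (fun u => ∑ p ∈ T, _) y = _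
        rw [iteratedDeriv_fun_sum fun p _ => by fun_prop]
        refine Finset.sum_congr rfl fun p _ => ?_
        rw [iteratedDeriv_const_mul_field, iteratedDeriv_pow_div_factorial]
        ring
      simp only [hj]
      rw [multiD_sum_smul β _ fun p _ => (contDiff_taylorMonomial x₀ p.1).contDiffAt]
      simp only [← he, ← hx₀, multiD_taylorMonomial]
      rw [Finset.sum_eq_single (β, j)]
      · simp [cf]
      · intro p _ hp
        by_cases h1 : j = p.2
        · rw [if_neg (c := p.1 = β), mul_zero]
          intro h2
          exact hp (Prod.ext h2 h1.symm)
        · simp [h1]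
      · intro hp
        simp [cf, hT σ (β, j) hp]
    · change multiD γ.1 ((fun z => h (e z)) ∘ e.symm) x₀ = _
      have hev : (fun z => h (e z)) ∘ e.symm =ᶠ[nhds x₀] h := by
        filter_upwards [extChartAt_target_mem_nhds (I := 𝓡 n) b] with x hx
        rw [Function.comp_apply, e.right_inv hx]
      rw [multiD_congr γ.1 hev, multiD_sum_smul γ.1 _ fun δ _ =>
        (contDiff_taylorMonomial x₀ δ).contDiffAt]
      simp only [multiD_taylorMonomial]
      by_cases hγ : γ.1 ∈ T'
      · simp [hγ, cg, γ.2]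
      · simp [hγ, hT' γ hγ]

end Pairs

/-! ### The derivation `∇` on jet coordinates -/

section Derivations

variable (F : Type*) [Field F] [Algebra (RatFunc ℝ) F]

/-- A real number as an element of `F`. -/
def realConst : ℝ →+* F := (algebraMap (RatFunc ℝ) F).comp RatFunc.C

variable [FiniteDimensional (RatFunc ℝ) F]

theorem fieldDeriv_realConst (c : ℝ) : fieldDeriv F (realConst F c) = 0 := by
  have : Algebra.FormallyEtale (Polynomial ℝ) (RatFunc ℝ) :=
    Algebra.FormallyEtale.of_isLocalization (nonZeroDivisors (Polynomial ℝ))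
  have : Algebra.FormallyEtale (RatFunc ℝ) F := Algebra.FormallyEtale.of_isSeparable _ _
  have h1 : ratDeriv (RatFunc.C c) = 0 := by
    rw [← RatFunc.algebraMap_C]
    refine (etaleExtend_algebraMap (Polynomial ℝ) (RatFunc ℝ) _ _).trans ?_
    change algebraMap (Polynomial ℝ) (RatFunc ℝ) (Polynomial.derivative (Polynomial.C c)) = 0
    simp
  refine (etaleExtend_algebraMap (RatFunc ℝ) F ratDeriv (RatFunc.C c)).trans ?_
  rw [h1, map_zero]

variable {V : Type*} (e : V → MvPolynomial V F)

theorem polyDeriv_C (w : F) : polyDeriv F e (C w) = C (fieldDeriv F w) := by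
  change (polyDerivHom F e (C w)).snd = _
  simp [polyDerivHom]

theorem polyDeriv_X (v : V) : polyDeriv F e (X v) = e v := by
  change (polyDerivHom F e (X v)).snd = _
  simp [polyDerivHom]

theorem polyDeriv_realConst_mul (c : ℝ) (p : MvPolynomial V F) :
    polyDeriv F e (C (realConst F c) * p) = C (realConst F c) * polyDeriv F e p := by
  rw [Derivation.leibniz, polyDeriv_C, fieldDeriv_realConst]
  simp

theorem nabla_algebraMap (n k : ℕ) (p : JetPoly F n k) :
    nabla F n k (algebraMap (JetPoly F n k) (JetField F n k) p) =
      algebraMap (JetPoly F n k) (JetField F n k) (polyDeriv F (shiftVar F n k) p) :=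
  haveI : Algebra.FormallyEtale (JetPoly F n k) (JetField F n k) :=
    Algebra.FormallyEtale.of_isLocalization (nonZeroDivisors (JetPoly F n k))
  etaleExtend_algebraMap _ _ _ p

end Derivations

/-! ### Substitutions on rational functions -/

section FieldSubst

variable {F : Type*} [Field F] {n k : ℕ} {Φ : JetPoly F n k →ₐ[F] JetPoly F n k}

/-- The extension of an injective substitution to rational functions. -/
def fieldSubst (Φ : JetPoly F n k →ₐ[F] JetPoly F n k) (hinj : Function.Injective Φ) :
    JetField F n k →ₐ[F] JetField F n k :=
  IsFractionRing.liftAlgHom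
    (g := (IsScalarTower.toAlgHom F (JetPoly F n k) (JetField F n k)).comp Φ)
    ((IsFractionRing.injective (JetPoly F n k) (JetField F n k)).comp hinj)

theorem fieldSubst_algebraMap (hinj : Function.Injective Φ) (p : JetPoly F n k) :
    fieldSubst Φ hinj (algebraMap (JetPoly F n k) (JetField F n k) p) =
      algebraMap (JetPoly F n k) (JetField F n k) (Φ p) := by
  have hg : Function.Injective
      ((IsScalarTower.toAlgHom F (JetPoly F n k) (JetField F n k)).comp Φ).toRingHom :=
    (IsFractionRing.injective (JetPoly F n k) (JetField F n k)).comp hinj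
  exact IsFractionRing.lift_algebraMap (K := JetField F n k) hg p

end FieldSubst

/-! ### The substitution induced by a local diffeomorphism -/

section Substitution

variable {F : Type*} [Field F] [Algebra (RatFunc ℝ) F] {n k : ℕ}
  {M : Type*} [TopologicalSpace M] [ChartedSpace (EuclideanSpace ℝ (Fin n)) M]

/-- The linear substitution of the jet coordinates with real coefficients `R` on the coordinates of
operators, the same for each order `j` of differentiation in `u`, and `S` on those of functions. -/
def linearSubst (F : Type*) [Field F] [Algebra (RatFunc ℝ) F]
    (R : multiIndices n k → (Fin n → ℕ) → multiIndices n k → (Fin n → ℕ) → ℝ)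
    (S : {γ : Fin n → ℕ // γ ≠ 0} → {γ : Fin n → ℕ // γ ≠ 0} → ℝ) :
    JetVar n k → JetPoly F n k
  | Sum.inl (σ, β, j) => ∑ τ, ∑ δ ∈ multiIndices n (∑ i, β i),
      C (realConst F (R σ β τ δ)) * X (Sum.inl (τ, δ, j))
  | Sum.inr γ => ∑ δ ∈ (multiIndices n (∑ i, γ.1 i)).subtype (· ≠ 0),
      C (realConst F (S γ δ)) * X (Sum.inr δ)

/-- `Φ` describes the action of `φ` on functions of the jets of related pairs: the value of `P` at
the jet of the image of a pair is the value of `Φ P` at the jet of the pair. -/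
structure IsJetSubst [FiniteDimensional (RatFunc ℝ) F] (b : M)
    (φ : PartialDiffeomorph (𝓡 n) (𝓡 n) M M ∞) (Φ : JetPoly F n k →ₐ[F] JetPoly F n k) :
    Prop where
  evalJet_push : ∀ (y : ℝ) (ρ : F →+* LaurentSeries ℂ) (A : (M → ℝ) → M → ℝ → ℝ) (f : M → ℝ),
    IsRelatedPairAt (n := n) k b y ρ A f → ∀ P : JetPoly F n k,
      evalJet (jetOf k b y (pushOperator φ A) (pushFunction φ f)) P =
        evalJet (jetOf k b y A f) (Φ P)
  polyDeriv_comm : ∀ P, polyDeriv F (shiftVar F n k) (Φ P) = Φ (polyDeriv F (shiftVar F n k) P)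
  map_X_inl : ∀ s, Φ (X (Sum.inl s)) ∈ Algebra.adjoin F (Set.range fun s => X (Sum.inl s))

theorem evalJet_aeval_linearSubst
    {R : multiIndices n k → (Fin n → ℕ) → multiIndices n k → (Fin n → ℕ) → ℝ}
    {S : {γ : Fin n → ℕ // γ ≠ 0} → {γ : Fin n → ℕ // γ ≠ 0} → ℝ} {θ θ' : JetVar n k → ℝ}
    (hR : ∀ σ β j, θ' (Sum.inl (σ, β, j)) =
      ∑ τ, ∑ δ ∈ multiIndices n (∑ i, β i), R σ β τ δ * θ (Sum.inl (τ, δ, j)))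
    (hS : ∀ γ, θ' (Sum.inr γ) =
      ∑ δ ∈ (multiIndices n (∑ i, γ.1 i)).subtype (· ≠ 0), S γ δ * θ (Sum.inr δ))
    (P : JetPoly F n k) : evalJet θ' P = evalJet θ (aeval (linearSubst F R S) P) := by
  have hC : ∀ (θ : JetVar n k → ℝ) (w : F), evalJet θ (C w) = w := fun θ w => eval_C w
  have hX : ∀ (θ : JetVar n k → ℝ) (v : JetVar n k),
      evalJet (F := F) θ (X v) = realConst F (θ v) := fun θ v => eval_X v
  have h : (evalJet (F := F) θ') =
      (evalJet θ).comp (aeval (R := F) (linearSubst F R S)).toRingHom := by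
    apply MvPolynomial.ringHom_ext
    · intro w
      rw [hC, RingHom.comp_apply]
      change w = evalJet θ (aeval (linearSubst F R S) (C w))
      rw [aeval_C, algebraMap_eq, hC]
    · intro v
      rw [hX, RingHom.comp_apply]
      change _ = evalJet θ (aeval (linearSubst F R S) (X v))
      rw [aeval_X]
      rcases v with ⟨σ, β, j⟩ | γ
      · rw [hR]
        simp only [linearSubst, map_sum, map_mul, hC, hX]
      · rw [hS]
        simp only [linearSubst, map_sum, map_mul, hC, hX]
  exact congrArg (fun g => g P) h

/-- A polynomial that vanishes at the jets of all related pairs is zero. -/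
theorem eq_zero_of_evalJet_eq_zero [IsManifold (𝓡 n) ∞ M] (b : M) {y : ℝ}
    {ρ : F →+* LaurentSeries ℂ} (hρ : IsBranchAt y ρ) {P : JetPoly F n k}
    (hP : ∀ A f, IsRelatedPairAt (n := n) k b y ρ A f → evalJet (jetOf k b y A f) P = 0) :
    P = 0 := by
  classical
  refine MvPolynomial.funext_set (fun _ => Set.range (realConst F))
    (fun _ => Set.infinite_range_of_injective (realConst F).injective) fun x hx => ?_
  choose θ hθ using fun v => hx v (Set.mem_univ v)
  obtain ⟨A, f, hAf, hjet⟩ := exists_isRelatedPairAt_jetOf_eq b hρ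
    (Finsupp.onFinset P.vars (fun v => if v ∈ P.vars then θ v else 0)
      (fun v hv => by by_contra h; simp [h] at hv))
  have h := hP A f hAf
  rw [hjet] at h
  rw [map_zero, ← h]
  refine eval₂Hom_congr' rfl (fun v hv _ => ?_) rfl
  rw [← hθ v, Finsupp.onFinset_apply, if_pos hv]
  rfl

variable [FiniteDimensional (RatFunc ℝ) F]

theorem exists_isJetSubst [IsManifold (𝓡 n) ∞ M] {b : M}
    {φ : PartialDiffeomorph (𝓡 n) (𝓡 n) M M ∞} (hb : b ∈ φ.source) (hφ : φ b = b) :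
    ∃ Φ : JetPoly F n k →ₐ[F] JetPoly F n k, IsJetSubst b φ Φ := by
  obtain ⟨R, hR⟩ := exists_jetOf_push_inl k hb hφ
  obtain ⟨S, hS⟩ := exists_jetOf_push_inr k hb hφ
  refine ⟨aeval (linearSubst F R S), ?_, ?_, ?_⟩
  · intro y ρ A f h P
    obtain ⟨a, ha, hA⟩ := h.isOperatorAt
    exact evalJet_aeval_linearSubst
      (fun σ β j => hR y A a (fun σ hσ => (ha σ hσ).1) hA f _ σ β j)
      (fun γ => hS y A _ f h.smoothNear γ) P
  · intro P
    induction P using MvPolynomial.induction_on with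
    | C w => rw [aeval_C, algebraMap_eq, polyDeriv_C, aeval_C, algebraMap_eq]
    | add p q hp hq => rw [map_add, map_add, map_add, map_add, hp, hq]
    | mul_X p v hp =>
      have hv : polyDeriv F (shiftVar F n k) (linearSubst F R S v) =
          aeval (linearSubst F R S) (shiftVar F n k v) := by
        rcases v with ⟨σ, β, j⟩ | γ
        · simp only [linearSubst, shiftVar, map_sum, polyDeriv_realConst_mul, polyDeriv_X, aeval_X]
        · simp only [linearSubst, shiftVar, map_sum, polyDeriv_realConst_mul, polyDeriv_X,
            map_zero, mul_zero, Finset.sum_const_zero]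
      rw [map_mul, Derivation.leibniz, Derivation.leibniz, hp, aeval_X, hv, polyDeriv_X]
      simp only [smul_eq_mul, map_add, map_mul, aeval_X]
  · rintro ⟨σ, β, j⟩
    rw [aeval_X]
    refine Subalgebra.sum_mem _ fun τ _ => Subalgebra.sum_mem _ fun δ _ => ?_
    exact Subalgebra.mul_mem _ (Subalgebra.algebraMap_mem _ _)
      (Algebra.subset_adjoin ⟨(τ, δ, j), rfl⟩)

/-- The substitution induced by `φ⁻¹` is a left inverse, by density of the jets. -/
theorem IsJetSubst.injective [IsManifold (𝓡 n) ∞ M] {b : M}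
    {φ : PartialDiffeomorph (𝓡 n) (𝓡 n) M M ∞} {Φ : JetPoly F n k →ₐ[F] JetPoly F n k}
    (hΦ : IsJetSubst b φ Φ) (hb : b ∈ φ.source) (hφ : φ b = b) {y : ℝ}
    {ρ : F →+* LaurentSeries ℂ} (hρ : IsBranchAt y ρ) : Function.Injective Φ := by
  obtain ⟨hb', hφ'⟩ := symm_fixes hb hφ
  obtain ⟨Φ', hΦ'⟩ := exists_isJetSubst (F := F) (k := k) hb' hφ'
  apply Function.LeftInverse.injective (g := Φ')
  intro P
  rw [← sub_eq_zero]
  refine eq_zero_of_evalJet_eq_zero b hρ fun A f h => ?_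
  rw [map_sub, ← hΦ'.evalJet_push y ρ A f h,
    ← hΦ.evalJet_push y ρ _ _ (h.push hρ hb' hφ'), jetOf_push_push_symm h hb hφ, sub_self]

/-! ### The induced endomorphism of the field of functions of jets -/

variable {Φ : JetPoly F n k →ₐ[F] JetPoly F n k}

variable {b : M} {φ : PartialDiffeomorph (𝓡 n) (𝓡 n) M M ∞}

theorem IsJetSubst.nabla_fieldSubst (hΦ : IsJetSubst b φ Φ) (hinj : Function.Injective Φ)
    (x : JetField F n k) :
    nabla F n k (fieldSubst Φ hinj x) = fieldSubst Φ hinj (nabla F n k x) := by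
  obtain ⟨p, q, -, rfl⟩ := IsFractionRing.div_surjective (A := JetPoly F n k) x
  simp only [map_div₀, Derivation.leibniz_div, fieldSubst_algebraMap, nabla_algebraMap,
    hΦ.polyDeriv_comm, smul_eq_mul, map_mul, map_sub, map_pow, map_inv₀]

theorem IsJetSubst.fieldSubst_mem (hΦ : IsJetSubst b φ Φ) (hinj : Function.Injective Φ)
    {x : JetField F n k} (hx : x ∈ fieldQ F n k 0) : fieldSubst Φ hinj x ∈ fieldQ F n k 0 := by
  have hle : fieldQ F n k 0 ≤ (fieldQ F n k 0).comap (fieldSubst Φ hinj) := by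
    refine IntermediateField.adjoin_le_iff.mpr ?_
    rintro _ (⟨s, rfl⟩ | ⟨γ, hγ, rfl⟩)
    · change fieldSubst Φ hinj (algebraMap (JetPoly F n k) (JetField F n k) (X (Sum.inl s))) ∈
        fieldQ F n k 0
      rw [fieldSubst_algebraMap]
      have : Algebra.adjoin F (Set.range fun s => (X (Sum.inl s) : JetPoly F n k)) ≤
          (fieldQ F n k 0).toSubalgebra.comap
            (IsScalarTower.toAlgHom F (JetPoly F n k) (JetField F n k)) := by
        refine Algebra.adjoin_le ?_
        rintro _ ⟨s, rfl⟩
        exact IntermediateField.subset_adjoin _ _ (Or.inl ⟨s, rfl⟩)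
      exact this (hΦ.map_X_inl s)
    · refine absurd ?_ γ.2
      ext i
      simpa using (Finset.sum_eq_zero_iff.mp (Nat.le_zero.mp hγ)) i (Finset.mem_univ i)
  exact hle hx

/-- An invariant is fixed by the substitutions induced by local diffeomorphisms: the two sides take
the same values at the jets of related pairs, and these jets are Zariski dense. -/
theorem IsInvariant.fieldSubst_eq [IsManifold (𝓡 n) ∞ M] {I : JetField F n k}
    (hI : IsInvariant b I) (hb : b ∈ φ.source) (hφ : φ b = b) {y : ℝ}
    {ρ : F →+* LaurentSeries ℂ} (hρ : IsBranchAt y ρ) (hΦ : IsJetSubst b φ Φ)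
    (hinj : Function.Injective Φ) : fieldSubst Φ hinj I = I := by
  obtain ⟨p, q, hq, hpq⟩ := IsFractionRing.div_surjective (A := JetPoly F n k) I
  have hq0 : q ≠ 0 := nonZeroDivisors.ne_zero hq
  have hΦq0 : Φ q ≠ 0 := (map_ne_zero_iff Φ hinj).mpr hq0
  -- the factor `q * Φ q` takes care of the jets at which one of the values is not defined
  have hzero : (Φ p * q - p * Φ q) * (q * Φ q) = 0 := by
    refine eq_zero_of_evalJet_eq_zero b hρ fun A f h => ?_
    have hinv := hI p q hq0 hpq.symm φ hb hφ y ρ hρ A f h.isOperatorAt h.smoothNear h.value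
    simp only [hΦ.evalJet_push y ρ A f h] at hinv
    simp only [map_mul, map_sub]
    by_cases h1 : evalJet (jetOf k b y A f) q = 0
    · rw [h1]; ring
    by_cases h2 : evalJet (jetOf k b y A f) (Φ q) = 0
    · rw [h2]; ring
    rw [(div_eq_div_iff h2 h1).mp (hinv h1 h2), sub_self, zero_mul]
  have heq : Φ p * q = p * Φ q :=
    sub_eq_zero.mp ((mul_eq_zero.mp hzero).resolve_right (mul_ne_zero hq0 hΦq0))
  have hinjA := IsFractionRing.injective (JetPoly F n k) (JetField F n k)
  rw [← hpq, map_div₀, fieldSubst_algebraMap, fieldSubst_algebraMap,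
    div_eq_div_iff ((map_ne_zero_iff _ hinjA).mpr hΦq0) ((map_ne_zero_iff _ hinjA).mpr hq0),
    ← map_mul, ← map_mul, heq]

/-- Conversely, a function fixed by all induced substitutions is an invariant. A branch may be
assumed to exist, because invariance is a condition on related pairs along branches. -/
theorem isInvariant_of_fieldSubst_eq [IsManifold (𝓡 n) ∞ M] {I : JetField F n k}
    (hI : ∀ φ : PartialDiffeomorph (𝓡 n) (𝓡 n) M M ∞, b ∈ φ.source → φ b = b →
      (∃ (y : ℝ) (ρ : F →+* LaurentSeries ℂ), IsBranchAt y ρ) →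
      ∀ (Φ : JetPoly F n k →ₐ[F] JetPoly F n k) (hinj : Function.Injective Φ),
        IsJetSubst b φ Φ → fieldSubst Φ hinj I = I) : IsInvariant b I := by
  intro p q hq0 hpq φ hb hφ y ρ hρ A f hA hf hfb h1 h2
  obtain ⟨Φ, hΦ⟩ := exists_isJetSubst (F := F) (k := k) hb hφ
  have hinj := hΦ.injective hb hφ hρ
  have h := hI φ hb hφ ⟨y, ρ, hρ⟩ Φ hinj hΦ
  have hinjA := IsFractionRing.injective (JetPoly F n k) (JetField F n k)
  have hΦq0 : Φ q ≠ 0 := (map_ne_zero_iff Φ hinj).mpr hq0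
  rw [hpq, map_div₀, fieldSubst_algebraMap, fieldSubst_algebraMap,
    div_eq_div_iff ((map_ne_zero_iff _ hinjA).mpr hΦq0) ((map_ne_zero_iff _ hinjA).mpr hq0),
    ← map_mul, ← map_mul] at h
  have hp := hΦ.evalJet_push y ρ A f ⟨hA, hf, hfb⟩
  rw [hp] at h2
  rw [hp, hp, div_eq_div_iff h2 h1, ← map_mul, ← map_mul, hinjA h]

/-- The endomorphism of `𝒬(0)` induced by a local diffeomorphism. -/
def fieldQSubst (hΦ : IsJetSubst b φ Φ) (hinj : Function.Injective Φ) :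
    fieldQ F n k 0 →+* fieldQ F n k 0 :=
  ((fieldSubst Φ hinj).toRingHom.comp (algebraMap (fieldQ F n k 0) (JetField F n k))).codRestrict
    (fieldQ F n k 0) fun x => hΦ.fieldSubst_mem hinj x.2

/-- If `I₀` is fixed, so are all `∇^i I₀`, and the ideal of relations is mapped into itself. -/
theorem map_fieldQSubst_mem_relationIdeal (hΦ : IsJetSubst b φ Φ) (hinj : Function.Injective Φ)
    {N : ℕ} {I₀ : JetField F n k} (hI₀ : fieldSubst Φ hinj I₀ = I₀)
    {p : MvPolynomial (Fin (N + 1)) (fieldQ F n k 0)} (hp : p ∈ relationIdeal F n k N I₀) :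
    MvPolynomial.map (fieldQSubst hΦ hinj) p ∈ relationIdeal F n k N I₀ := by
  have hI : ∀ i : ℕ, fieldSubst Φ hinj ((nabla F n k)^[i] I₀) = (nabla F n k)^[i] I₀ := by
    intro i
    induction i with
    | zero => exact hI₀
    | succ i ih => rw [Function.iterate_succ_apply', ← hΦ.nabla_fieldSubst, ih]
  rw [relationIdeal, RingHom.mem_ker] at hp ⊢
  have h := congrArg (fieldSubst Φ hinj).toRingHom hp
  rw [map_zero, aeval_def, hom_eval₂] at h
  rw [aeval_def, eval₂_map, ← h]
  congr 1
  funext i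
  exact (hI i).symm

end Substitution

end RelatedPairs
end

open scoped Manifold ContDiff in
open RelatedPairs in
theorem mainTheorem3 {n k r N : ℕ} {M : Type*} [TopologicalSpace M]
    [ChartedSpace (EuclideanSpace ℝ (Fin n)) M] [IsManifold (𝓡 n) ∞ M] (b : M)
    {F : Type*} [Field F] [Algebra (RatFunc ℝ) F] [FiniteDimensional (RatFunc ℝ) F]
    (I₀ : JetField F n k) (hI₀ : IsPairInvariant b r I₀) :
    ∃ B : Finset (MvPolynomial (Fin (N + 1)) (fieldQ F n k 0)),
      IsReducedGroebnerBasis MonomialOrder.lex (relationIdeal F n k N I₀) B ∧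
      (∀ B' : Finset (MvPolynomial (Fin (N + 1)) (fieldQ F n k 0)),
        IsReducedGroebnerBasis MonomialOrder.lex (relationIdeal F n k N I₀) B' → B' = B) ∧
      ∀ p ∈ B, ∀ d : Fin (N + 1) →₀ ℕ, IsNaturalInvariant b (algebraMap (fieldQ F n k 0) (JetField F n k) (p.coeff d)) := by
  obtain ⟨B, hB⟩ := exists_isReducedGroebnerBasis MonomialOrder.lex (relationIdeal F n k N I₀)
  refine ⟨B, hB, fun B' hB' => hB'.unique hB, fun p hp d => ⟨(p.coeff d).2, ?_⟩⟩
  refine isInvariant_of_fieldSubst_eq fun φ hb hφ ⟨y, ρ, hρ⟩ Φ hinj hΦ => ?_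
  have hfix := hI₀.2.fieldSubst_eq hb hφ hρ hΦ hinj
  have h := hB.map_coeff_eq (fieldQSubst hΦ hinj)
    (fun q hq => map_fieldQSubst_mem_relationIdeal hΦ hinj hfix hq) hp d
  exact congrArg (algebraMap (fieldQ F n k 0) (JetField F n k)) h
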